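/- Let $\mu\ge 1$ and $n\ge 5$ be integers. A 2-design consists of a finite point set and a finite (indexed) family of blocks (subsets of the point set), all of the same size, such that any two distinct points lie together in the same number of blocks. It is quasi-symmetric if the numbers $|B\cap C|$, for distinct blocks $B,C$ of the family, take exactly two values $\lambda_1<\lambda_2$; its defect is $\lambda_2-\lambda_1$, and its block graph has the blocks as vertices, two distinct blocks being adjacent if and only if they have exactly $\lambda_2$ points in common. Let $T_n^*$ be the complement of the line graph of the complete graph $K_n$. For a prime $p$ and non-zero rationals $a,b$, let $(a,b)_p=1$ if $ax^2+by^2=z^2$ has a solution $(x,y,z)\neq(0,0,0)$ in the field $\mathbb{Q}_p$ of $p$-adic numbers, and $(a,b)_p=-1$ otherwise. A solution of an equation in $x,y,z$ is non-trivial if $(x,y,z)\ne(0,0,0)$. For the existence of a quasi-symmetric 2-design of defect $\mu$ whose block graph is isomorphic to $T_n^*$, the following conditions are necessary: (a1) If $n\equiv 1\pmod 4$, then $\mu$ is a perfect square. (a2) If $n\equiv 2\pmod 4$, then $(n-2)\mu$ is a perfect square. (a3) If $n\equiv 3\pmod 4$, then $n-2$ is a perfect square. (b1) If $n\equiv 0\pmod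 4$, then $\left(\mu,(-1)^{n/4}\binom{n-1}{2}\right)_p=\left(n-2,(-1)^{n/4}2\right)_p$ for all primes $p$. (b2) If $n\equiv 1\pmod 4$, then the equation $(n-2)x^2+(-1)^{(n-1)/4}\,2y^2=z^2$ has a non-trivial solution in integers. (b3) If $n\equiv 2\pmod 4$, then $n-1$ is a sum of two squares of integers (zero allowed). (b4) If $n\equiv 3\pmod 4$, then the equation $\mu x^2+(-1)^{(n-3)/4}\binom{n-1}{2}y^2=z^2$ has a non-trivial solution in integers. -/

import Mathlib

/-- A family `B` of blocks (subsets of the finite point set `P`, indexed by `ι`) is a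
`2-(v, k, lam)` design: there are `v` points, every block has `k` points, and any two distinct
points are together in exactly `lam` blocks. Repeated blocks are allowed. -/
def IsTwoDesign {P ι : Type*} [Fintype P] [DecidableEq P] [Fintype ι]
    (B : ι → Finset P) (v k lam : ℕ) : Prop :=
  Fintype.card P = v ∧
  (∀ i, (B i).card = k) ∧
  ∀ x y : P, x ≠ y → (Finset.univ.filter (fun i => x ∈ B i ∧ y ∈ B i)).card = lam

/-- The set of intersection numbers: the sizes of `B i ∩ B j` for distinct blocks. -/
def intersectionNumbers {P ι : Type*} [DecidableEq P] (B : ι → Finset P) : Set ℕ :=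
  {x | ∃ i j, i ≠ j ∧ (B i ∩ B j).card = x}

/-- A quasi-symmetric 2-design: a 2-design with exactly two intersection numbers, the smaller
one being `l₁` and the larger one `l₂`. -/
def IsQuasiSymmetric {P ι : Type*} [Fintype P] [DecidableEq P] [Fintype ι]
    (B : ι → Finset P) (l₁ l₂ : ℕ) : Prop :=
  (∃ v k lam, IsTwoDesign B v k lam) ∧ l₁ < l₂ ∧ intersectionNumbers B = {l₁, l₂}

/-- The block graph: distinct blocks are adjacent iff they have exactly `l₂` points in common
(`l₂` will be the larger intersection number). -/
def blockGraph {P ι : Type*} [DecidableEq P] (B : ι → Finset P) (l₂ : ℕ) : SimpleGraph ι where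
  Adj i j := i ≠ j ∧ (B i ∩ B j).card = l₂
  symm := ⟨fun i j h => ⟨h.1.symm, by rw [Finset.inter_comm]; exact h.2⟩⟩
  loopless := ⟨fun _ h => h.1 rfl⟩

/-- The co-triangular graph `T_n^*`: the complement of the line graph of the complete graph
`K_n`. -/
def coTriangularGraph (n : ℕ) :
    SimpleGraph (⊤ : SimpleGraph (Fin n)).edgeSet :=
  ((⊤ : SimpleGraph (Fin n)).lineGraph)ᶜ

/-- `B` is a quasi-symmetric 2-design of defect `μ` (the difference of its two intersection
numbers) whose block graph is (isomorphic to) `T_n^*`. -/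
def IsCoTriangularDesign {P ι : Type*} [Fintype P] [DecidableEq P] [Fintype ι]
    (B : ι → Finset P) (n μ : ℕ) : Prop :=
  ∃ l₁ l₂ : ℕ, IsQuasiSymmetric B l₁ l₂ ∧ l₂ = l₁ + μ ∧
    Nonempty (blockGraph B l₂ ≃g coTriangularGraph n)

open Classical in
/-- The `p`-adic Hilbert symbol of (non-zero) rationals `a`, `b`: it is `1` if
`a x² + b y² = z²` has a solution `(x, y, z) ≠ (0, 0, 0)` in `ℚ_p`, and `-1` otherwise. -/
noncomputable def padicHilbertSymbol (p : ℕ) [Fact p.Prime] (a b : ℚ) : ℤ :=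
  if ∃ x y z : ℚ_[p], (x, y, z) ≠ (0, 0, 0) ∧ (a : ℚ_[p]) * x ^ 2 + (b : ℚ_[p]) * y ^ 2 = z ^ 2
  then 1 else -1

/-- The equation `a x² + b y² = z²` has a non-trivial solution in integers. -/
def HasNontrivialSolution (a b : ℤ) : Prop :=
  ∃ x y z : ℤ, (x, y, z) ≠ (0, 0, 0) ∧ a * x ^ 2 + b * y ^ 2 = z ^ 2

/-! Let `N` and `S` be the incidence matrices of blocks against points and of blocks against the `n`
vertices, a block being read as an edge of `K_n` through the graph isomorphism. Adjacent blocks are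
disjoint edges, so `G = N Nᵀ` equals `(l₁ + μ) J - μ S Sᵀ + ρ I`, while `Sᵀ S = (n - 2) I + J`.
Computing `G²` once from the design and once from this formula forces all parameters, and also
forces the columns of `N` and `S`, once made orthogonal to the all-one vector, to be orthogonal to
each other (`coTriangular_parameters`).

Hence the all-one column, the reduced columns of `N` and those of `S`, bordered by two constant
rows, form a square matrix of size `b + 2` with diagonal Gram matrix (`b` blocks, `v` points). It is
a rational equivalence between two explicit diagonal forms (`coTriangular_represents`). With `c = n
- 2` it becomes `⟨2(c+1), 2⟩ + v⟨cμ⟩ + (c+2)⟨c⟩ → (v+c+2)⟨1⟩ + ⟨2(c+1)μ, 2c⟩`.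

Comparing determinants modulo squares gives (a1)-(a3). For (b1)-(b4), four equal coefficients `a`
may be replaced by four ones (Lagrange and Euler, `Represents.four_squares`), and common terms are
cancelled (`Represents.cancel`), until small forms remain. Solvability of `ax² + by² = z²` means
that `⟨a, b⟩` and `⟨1, ab⟩` are equivalent (`ternaryIsotropic_iff`), and this is read off from what
remains, over `ℚ` or over `ℚ_p`.

Only pullbacks along linear maps, in one direction, are tracked: they compose, add and cancel, so
neither invertibility nor the full Witt theorem is required. -/

section DiagonalForms

/-! ### Diagonal quadratic forms and their linear pullbacks. -/

variable {K : Type*} [Field K]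

/-- There is a linear map `Kᶥ → Kᵏ` carrying the diagonal form `⟨d'⟩` back to `⟨d⟩`. -/
def DiagRep {ι κ : Type*} [Fintype ι] [Fintype κ] (d : ι → K) (d' : κ → K) : Prop :=
  ∃ f : (ι → K) →ₗ[K] (κ → K), ∀ x, ∑ j, d' j * f x j ^ 2 = ∑ i, d i * x i ^ 2

theorem DiagRep.trans {ι κ τ : Type*} [Fintype ι] [Fintype κ] [Fintype τ]
    {d : ι → K} {d' : κ → K} {d'' : τ → K} (h : DiagRep d d') (h' : DiagRep d' d'') :
    DiagRep d d'' := by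
  obtain ⟨f, hf⟩ := h
  obtain ⟨g, hg⟩ := h'
  exact ⟨g.comp f, fun x => by rw [← hf, ← hg]; rfl⟩

theorem DiagRep.of_equiv {ι κ : Type*} [Fintype ι] [Fintype κ]
    {d : ι → K} {d' : κ → K} (e : κ ≃ ι) (h : ∀ j, d (e j) = d' j) : DiagRep d d' := by
  refine ⟨LinearMap.funLeft K K e, fun x => ?_⟩
  rw [← e.sum_comp]
  simp [LinearMap.funLeft_apply, h]

theorem DiagRep.sum {ι κ ι' κ' : Type*} [Fintype ι] [Fintype κ] [Fintype ι'] [Fintype κ']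
    {d : ι → K} {d' : κ → K} {c : ι' → K} {c' : κ' → K} (h : DiagRep d d') (h' : DiagRep c c') :
    DiagRep (Sum.elim d c) (Sum.elim d' c') := by
  obtain ⟨f, hf⟩ := h
  obtain ⟨g, hg⟩ := h'
  refine ⟨{ toFun := fun x => Sum.elim (f (x ∘ Sum.inl)) (g (x ∘ Sum.inr))
            map_add' := fun x y => ?_
            map_smul' := fun a x => ?_ }, fun x => ?_⟩
  · have h1 : (x + y) ∘ (Sum.inl : ι → ι ⊕ ι') = x ∘ Sum.inl + y ∘ Sum.inl := rfl
    have h2 : (x + y) ∘ (Sum.inr : ι' → ι ⊕ ι') = x ∘ Sum.inr + y ∘ Sum.inr := rfl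
    rw [h1, h2, map_add, map_add]
    ext (i | i) <;> simp
  · have h1 : (a • x) ∘ (Sum.inl : ι → ι ⊕ ι') = a • (x ∘ Sum.inl) := rfl
    have h2 : (a • x) ∘ (Sum.inr : ι' → ι ⊕ ι') = a • (x ∘ Sum.inr) := rfl
    rw [h1, h2, map_smul, map_smul]
    ext (i | i) <;> simp
  · simp [hf, hg]

theorem DiagRep.smul {ι κ : Type*} [Fintype ι] [Fintype κ]
    {d : ι → K} {d' : κ → K} (a : K) (h : DiagRep d d') :
    DiagRep (fun i => a * d i) (fun j => a * d' j) := by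
  obtain ⟨f, hf⟩ := h
  exact ⟨f, fun x => by simp only [mul_assoc, ← Finset.mul_sum, hf]⟩

/-- The trick of Bruck and Ryser, a weak form of Witt cancellation. -/
theorem DiagRep.cancel (h2 : (2 : K) ≠ 0) {ι κ : Type*} [Fintype ι] [Fintype κ]
    {d : ι → K} {d' : κ → K} {a : K}
    (h : DiagRep (Sum.elim d (fun _ : Unit => a)) (Sum.elim d' (fun _ : Unit => a))) :
    DiagRep d d' := by
  obtain ⟨f, hf⟩ := h
  let inl : (ι → K) →ₗ[K] (ι ⊕ Unit → K) :=
    { toFun := fun x => Sum.elim x 0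
      map_add' := fun x y => by ext (i | i) <;> simp
      map_smul' := fun a x => by ext (i | i) <;> simp }
  let u : ι ⊕ Unit → K := Sum.elim 0 1
  let α : (ι → K) →ₗ[K] K := LinearMap.proj (Sum.inr ()) ∘ₗ f ∘ₗ inl
  let β : K := f u (Sum.inr ())
  -- On the vectors `(x, c * α x)` the last coordinate of the image is `α x * (1 + c * β)`. With
  -- this `c` it agrees up to sign with the last source coordinate, so the two terms with
  -- coefficient `a` drop out.
  have key : ∃ c : K, ∀ t, (t + c * t * β) ^ 2 = (c * t) ^ 2 := by
    by_cases hβ : β = 1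
    · exact ⟨-1 / 2, fun t => by rw [hβ]; field_simp; ring⟩
    · have : 1 - β ≠ 0 := sub_ne_zero.2 (Ne.symm hβ)
      exact ⟨1 / (1 - β), fun t => by field_simp; ring⟩
  obtain ⟨c, hc⟩ := key
  let g : (ι → K) →ₗ[K] (κ ⊕ Unit → K) :=
    f ∘ₗ (inl + (LinearMap.toSpanSingleton K _ u) ∘ₗ (c • α))
  refine ⟨LinearMap.funLeft K K Sum.inl ∘ₗ g, fun x => ?_⟩
  have h1 := hf ((inl + (LinearMap.toSpanSingleton K _ u) ∘ₗ (c • α)) x)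
  have h3 : f ((inl + (LinearMap.toSpanSingleton K _ u) ∘ₗ (c • α)) x) = g x := rfl
  have h4 : g x (Sum.inr ()) = α x + c * α x * β := by
    simp [g, α, β, LinearMap.toSpanSingleton_apply]
  rw [h3] at h1
  simp only [Fintype.sum_sum_type, Sum.elim_inl, Sum.elim_inr, Finset.univ_unique,
    Finset.sum_singleton, PUnit.default_eq_unit, h4, hc] at h1
  simp [inl, u, LinearMap.toSpanSingleton_apply] at h1
  simpa [LinearMap.funLeft_apply] using h1

theorem DiagRep.polar (h2 : (2 : K) ≠ 0) {ι κ : Type*} [Fintype ι] [Fintype κ]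
    {d : ι → K} {d' : κ → K} {f : (ι → K) →ₗ[K] (κ → K)}
    (hf : ∀ x, ∑ j, d' j * f x j ^ 2 = ∑ i, d i * x i ^ 2) (x y : ι → K) :
    ∑ j, d' j * (f x j * f y j) = ∑ i, d i * (x i * y i) := by
  have h := hf (x + y)
  have e1 : ∑ j, d' j * f (x + y) j ^ 2 =
      ∑ j, d' j * f x j ^ 2 + ∑ j, d' j * f y j ^ 2 + 2 * ∑ j, d' j * (f x j * f y j) := by
    rw [Finset.mul_sum, ← Finset.sum_add_distrib, ← Finset.sum_add_distrib]
    refine Finset.sum_congr rfl fun j _ => ?_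
    rw [map_add, Pi.add_apply]; ring
  have e2 : ∑ i, d i * (x + y) i ^ 2 =
      ∑ i, d i * x i ^ 2 + ∑ i, d i * y i ^ 2 + 2 * ∑ i, d i * (x i * y i) := by
    rw [Finset.mul_sum, ← Finset.sum_add_distrib, ← Finset.sum_add_distrib]
    refine Finset.sum_congr rfl fun j _ => ?_
    rw [Pi.add_apply]; ring
  rw [e1, e2, hf, hf] at h
  exact mul_left_cancel₀ h2 (add_left_cancel h)

/-- A matrix whose columns have the prescribed Gram matrix gives a representation. -/
theorem DiagRep.of_columns {ι κ : Type*} [Fintype ι] [Fintype κ] [DecidableEq ι]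
    {d : ι → K} {d' : κ → K} (M : κ → ι → K)
    (hM : ∀ i i', ∑ j, d' j * (M j i * M j i') = if i = i' then d i else 0) : DiagRep d d' := by
  refine ⟨Matrix.mulVecLin (Matrix.of M), fun x => ?_⟩
  have : ∀ j, d' j * (Matrix.mulVecLin (Matrix.of M) x j) ^ 2 =
      ∑ i, ∑ i', d' j * (M j i * M j i') * (x i * x i') := fun j => by
    simp only [Matrix.mulVecLin_apply, Matrix.mulVec, dotProduct, Matrix.of_apply, sq,
      Finset.sum_mul_sum]
    rw [Finset.mul_sum]
    refine Finset.sum_congr rfl fun i _ => ?_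
    rw [Finset.mul_sum]
    exact Finset.sum_congr rfl fun i' _ => by ring
  simp only [this]
  rw [Finset.sum_comm]
  refine Finset.sum_congr rfl fun i _ => ?_
  rw [Finset.sum_comm]
  simp only [← Finset.sum_mul, hM]
  simp [sq]

theorem DiagRep.exists_columns (h2 : (2 : K) ≠ 0) {ι κ : Type*} [Fintype ι] [Fintype κ]
    [DecidableEq ι] {d : ι → K} {d' : κ → K} (h : DiagRep d d') :
    ∃ M : κ → ι → K, ∀ i i', ∑ j, d' j * (M j i * M j i') = if i = i' then d i else 0 := by
  obtain ⟨f, hf⟩ := h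
  refine ⟨fun j i => f (Pi.single i 1) j, fun i i' => ?_⟩
  rw [DiagRep.polar h2 hf]
  simp only [Pi.single_apply, mul_ite, mul_one, mul_zero, Finset.sum_ite_eq',
    Finset.mem_univ, if_true]
  grind

theorem DiagRep.map {L : Type*} [Field L] (φ : K →+* L) (h2 : (2 : K) ≠ 0)
    {ι κ : Type*} [Fintype ι] [Fintype κ]
    {d : ι → K} {d' : κ → K} (h : DiagRep d d') :
    DiagRep (fun i => φ (d i)) (fun j => φ (d' j)) := by
  classical
  obtain ⟨M, hM⟩ := h.exists_columns h2
  refine DiagRep.of_columns (fun j i => φ (M j i)) fun i i' => ?_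
  have := congrArg φ (hM i i')
  rw [map_sum, apply_ite φ, map_zero] at this
  simpa using this

/-- Taking determinants in `Mᵀ D' M = D`; the witness is `det M`, which may vanish. -/
theorem DiagRep.exists_prod_eq (h2 : (2 : K) ≠ 0) {ι : Type*} [Fintype ι]
    {d d' : ι → K} (h : DiagRep d d') : ∃ t, ∏ i, d i = t ^ 2 * ∏ i, d' i := by
  classical
  obtain ⟨M, hM⟩ := h.exists_columns h2
  have : (Matrix.of M).transpose * Matrix.diagonal d' * Matrix.of M = Matrix.diagonal d := by
    ext i i'
    rw [Matrix.mul_apply, Matrix.diagonal_apply, ← hM]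
    refine Finset.sum_congr rfl fun j _ => ?_
    rw [Matrix.mul_diagonal]
    simp only [Matrix.transpose_apply, Matrix.of_apply]; ring
  refine ⟨(Matrix.of M).det, ?_⟩
  have := congrArg Matrix.det this
  rw [Matrix.det_mul, Matrix.det_mul, Matrix.det_transpose, Matrix.det_diagonal,
    Matrix.det_diagonal] at this
  rw [← this]; ring

end DiagonalForms

/-! ### Diagonal forms as multisets of coefficients. -/

theorem exists_equiv_of_map_univ_eq {ι κ α : Type*} [Fintype ι] [Fintype κ] {d : ι → α}
    {d' : κ → α} (h : Finset.univ.val.map d = Finset.univ.val.map d') :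
    ∃ e : κ ≃ ι, ∀ j, d (e j) = d' j := by
  classical
  have hc : ∀ c, Nonempty ({j // d' j = c} ≃ {i // d i = c}) := fun c => by
    rw [← Fintype.card_eq, Fintype.card_subtype, Fintype.card_subtype]
    have := congrArg (Multiset.count c) h
    rw [Multiset.count_map, Multiset.count_map] at this
    simp only [Finset.card_def, Finset.filter_val, eq_comm (b := c)]
    simpa [eq_comm] using this.symm
  exact ⟨Equiv.ofFiberEquiv fun c => (hc c).some, fun j => Equiv.ofFiberEquiv_map _ j⟩

theorem Multiset.exists_map_univ_eq {α : Type*} (s : Multiset α) :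
    ∃ (m : ℕ) (d : Fin m → α), Finset.univ.val.map d = s := by
  induction s using Quotient.inductionOn with
  | h l => exact ⟨l.length, l.get, by rw [Fin.univ_val_map, List.ofFn_get]; rfl⟩

section RepresentedForms

variable {K : Type*} [Field K]

/-- The diagonal form with coefficients `s` is a pullback, along a linear map, of the one with
coefficients `t`. -/
def Represents (s t : Multiset K) : Prop :=
  ∃ (m k : ℕ) (d : Fin m → K) (d' : Fin k → K),
    Finset.univ.val.map d = s ∧ Finset.univ.val.map d' = t ∧ DiagRep d d'

theorem represents_map_univ_iff {ι κ : Type*} [Fintype ι] [Fintype κ] {d : ι → K} {d' : κ → K} :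
    Represents (Finset.univ.val.map d) (Finset.univ.val.map d') ↔ DiagRep d d' := by
  constructor
  · rintro ⟨m, k, c, c', hc, hc', h⟩
    obtain ⟨e, he⟩ := exists_equiv_of_map_univ_eq hc.symm
    obtain ⟨e', he'⟩ := exists_equiv_of_map_univ_eq hc'
    exact (DiagRep.of_equiv e he).trans (h.trans (DiagRep.of_equiv e' he'))
  · intro h
    obtain ⟨_, c, hc⟩ := (Finset.univ.val.map d).exists_map_univ_eq
    obtain ⟨_, c', hc'⟩ := (Finset.univ.val.map d').exists_map_univ_eq
    obtain ⟨e, he⟩ := exists_equiv_of_map_univ_eq hc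
    obtain ⟨e', he'⟩ := exists_equiv_of_map_univ_eq hc'.symm
    exact ⟨_, _, c, c', hc, hc', (DiagRep.of_equiv e he).trans (h.trans (DiagRep.of_equiv e' he'))⟩

theorem map_univ_sum_elim {ι κ α : Type*} [Fintype ι] [Fintype κ] (d : ι → α) (c : κ → α) :
    Finset.univ.val.map (Sum.elim d c) = Finset.univ.val.map d + Finset.univ.val.map c := by
  rw [← Finset.univ_disjSum_univ]
  simp [Finset.disjSum, Multiset.disjSum, Multiset.map_map, Function.comp_def]

namespace Represents

theorem trans {s t u : Multiset K} (h : Represents s t) (h' : Represents t u) :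
    Represents s u := by
  obtain ⟨m, k, c, c', rfl, rfl, h⟩ := h
  obtain ⟨_, d, rfl⟩ := u.exists_map_univ_eq
  rw [represents_map_univ_iff] at *
  exact h.trans h'

theorem refl (s : Multiset K) : Represents s s := by
  obtain ⟨_, d, hd⟩ := s.exists_map_univ_eq
  rw [← hd, represents_map_univ_iff]
  exact DiagRep.of_equiv (Equiv.refl _) fun _ => rfl

theorem add {s t s' t' : Multiset K} (h : Represents s t) (h' : Represents s' t') :
    Represents (s + s') (t + t') := by
  obtain ⟨m, k, c, c', rfl, rfl, h⟩ := h
  obtain ⟨m', k', d, d', rfl, rfl, h'⟩ := h'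
  rw [← map_univ_sum_elim, ← map_univ_sum_elim, represents_map_univ_iff]
  exact h.sum h'

theorem nsmul {s t : Multiset K} (h : Represents s t) (n : ℕ) : Represents (n • s) (n • t) := by
  induction n with
  | zero => simpa using refl 0
  | succ n ih => rw [succ_nsmul, succ_nsmul]; exact ih.add h

theorem cancel_singleton (h2 : (2 : K) ≠ 0) {s t : Multiset K} {a : K}
    (h : Represents (s + {a}) (t + {a})) : Represents s t := by
  obtain ⟨_, d, rfl⟩ := s.exists_map_univ_eq
  obtain ⟨_, d', rfl⟩ := t.exists_map_univ_eq
  have ha : ({a} : Multiset K) = Finset.univ.val.map (fun _ : Unit => a) := by simp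
  rw [ha, ← map_univ_sum_elim, ← map_univ_sum_elim, represents_map_univ_iff] at h
  rw [represents_map_univ_iff]
  exact h.cancel h2

theorem cancel (h2 : (2 : K) ≠ 0) {s t : Multiset K} (u : Multiset K)
    (h : Represents (s + u) (t + u)) : Represents s t := by
  induction u using Multiset.induction_on with
  | empty => simpa using h
  | cons a u ih =>
    refine ih (cancel_singleton h2 (a := a) ?_)
    rwa [add_assoc, add_assoc, add_comm u, Multiset.singleton_add]

theorem scale {s t : Multiset K} (a : K) (h : Represents s t) :
    Represents (s.map (a * ·)) (t.map (a * ·)) := by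
  obtain ⟨m, k, c, c', rfl, rfl, h⟩ := h
  rw [Multiset.map_map, Multiset.map_map, represents_map_univ_iff]
  exact h.smul a

theorem map {L : Type*} [Field L] (φ : K →+* L) (h2 : (2 : K) ≠ 0) {s t : Multiset K}
    (h : Represents s t) : Represents (s.map φ) (t.map φ) := by
  obtain ⟨m, k, c, c', rfl, rfl, h⟩ := h
  rw [Multiset.map_map, Multiset.map_map, represents_map_univ_iff]
  exact h.map φ h2

theorem exists_prod_eq (h2 : (2 : K) ≠ 0) {s t : Multiset K} (h : Represents s t)
    (hc : s.card = t.card) : ∃ x, s.prod = x ^ 2 * t.prod := by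
  obtain ⟨_, d, hd⟩ := s.exists_map_univ_eq
  obtain ⟨_, d', hd'⟩ := t.exists_map_univ_eq
  rw [← hd, ← hd', represents_map_univ_iff] at h
  rw [← hd, ← hd', Multiset.card_map, Multiset.card_map, Finset.card_val, Finset.card_val,
    Finset.card_fin, Finset.card_fin] at hc
  subst hc
  rw [← hd, ← hd']
  exact h.exists_prod_eq h2

/-- Multiplying a coefficient by a square. -/
theorem of_eq_mul_sq {a b t : K} (h : a = b * t ^ 2) : Represents ({a} : Multiset K) {b} := by
  have h1 := represents_map_univ_iff (d := fun _ : Unit => a) (d' := fun _ : Unit => b)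
  simp only [Finset.univ_unique, Finset.singleton_val, Multiset.map_singleton] at h1
  rw [h1]
  refine DiagRep.of_columns (fun _ _ => t) fun _ _ => ?_
  simp [h, sq]

theorem pair_iff {a b c d : K} : Represents ({a} + {b} : Multiset K) ({c} + {d}) ↔
    DiagRep ![a, b] ![c, d] := by
  rw [← represents_map_univ_iff]
  simp [Multiset.singleton_add, ← Multiset.cons_coe]

/-- If `⟨a, b⟩` takes the value `s`, then `⟨s, abs⟩` is represented by `⟨a, b⟩`. -/
theorem pair {a b s : K} (x y : K) (h : s = a * x ^ 2 + b * y ^ 2) :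
    Represents ({s} + {a * b * s} : Multiset K) ({a} + {b}) := by
  rw [pair_iff]
  refine DiagRep.of_columns ![![x, -b * y], ![y, a * x]] fun i j => ?_
  fin_cases i <;> fin_cases j <;> simp [Fin.sum_univ_two, h] <;> ring

/-- If `⟨a, b⟩` takes the nonzero value `s`, then `⟨a, b⟩` is represented by `⟨s, abs⟩`. -/
theorem pair' {a b s : K} (x y : K) (h : s = a * x ^ 2 + b * y ^ 2) (hs : s ≠ 0) :
    Represents ({a} + {b} : Multiset K) ({s} + {a * b * s}) := by
  rw [pair_iff]
  refine DiagRep.of_columns ![![a * x / s, b * y / s], ![-y / s, x / s]] fun i j => ?_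
  fin_cases i <;> fin_cases j <;> simp [Fin.sum_univ_two] <;> field_simp <;> rw [h] <;> ring

theorem exists_of_pair (h2 : (2 : K) ≠ 0) {s a b : K} {t : Multiset K}
    (h : Represents ({s} + t) ({a} + {b} : Multiset K)) :
    ∃ x y, s = a * x ^ 2 + b * y ^ 2 := by
  obtain ⟨_, d, rfl⟩ := t.exists_map_univ_eq
  have ha : ({s} : Multiset K) = Finset.univ.val.map (fun _ : Unit => s) := by simp
  have hb : ({a} + {b} : Multiset K) = Finset.univ.val.map ![a, b] := by
    simp [Multiset.singleton_add, ← Multiset.cons_coe]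
  rw [ha, hb, ← map_univ_sum_elim, represents_map_univ_iff] at h
  obtain ⟨M, hM⟩ := h.exists_columns h2
  have := hM (Sum.inl ()) (Sum.inl ())
  simp [Fin.sum_univ_two] at this
  exact ⟨M 0 (Sum.inl ()), M 1 (Sum.inl ()), by rw [← this]; ring⟩

/-- A positive multiple of a sum of four squares is equivalent to it. -/
theorem four_squares [CharZero K] {a : ℕ} (ha : a ≠ 0) :
    Represents (4 • {(a : K)}) (4 • {1}) ∧ Represents (4 • {1}) (4 • {(a : K)}) := by
  obtain ⟨p, q, r, s, h⟩ := Nat.sum_four_squares a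
  have ha' : (a : K) ≠ 0 := by exact_mod_cast ha
  have h' : (a : K) = (p : K) ^ 2 + q ^ 2 + r ^ 2 + s ^ 2 := by exact_mod_cast h.symm
  have e : ∀ b : K, 4 • ({b} : Multiset K) = Finset.univ.val.map (fun _ : Fin 4 => b) := by
    intro b; simp [Multiset.nsmul_singleton]
  simp only [e, represents_map_univ_iff]
  constructor
  -- The matrix of multiplication by the quaternion `p + qi + rj + sk`: its columns are orthogonal
  -- of norm `a`. Dividing it by `a` serves the converse direction.
  · refine DiagRep.of_columns
      ![![(p : K), -q, -r, -s], ![q, p, -s, r], ![r, s, p, -q], ![s, -r, q, p]] fun i j => ?_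
    fin_cases i <;> fin_cases j <;> simp [Fin.sum_univ_four, h'] <;> ring
  · refine DiagRep.of_columns
      ![![p / (a : K), -q / a, -r / a, -s / a], ![q / a, p / a, -s / a, r / a],
        ![r / a, s / a, p / a, -q / a], ![s / a, -r / a, q / a, p / a]] fun i j => ?_
    fin_cases i <;> fin_cases j <;> simp [Fin.sum_univ_four] <;> field_simp <;>
      simp only [h'] <;> ring

end Represents

end RepresentedForms

/-! ### Edges and vertices of the complete graph. -/

section Pairs

variable {n : ℕ}

open Finset

/-- The incidence matrix of the edges and vertices of the complete graph `K_n`. -/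
def pairIncidence (x : (⊤ : SimpleGraph (Fin n)).edgeSet) (a : Fin n) : ℚ :=
  if a ∈ (x : Sym2 (Fin n)) then 1 else 0

theorem sum_pairIncidence (x : (⊤ : SimpleGraph (Fin n)).edgeSet) :
    ∑ a, pairIncidence x a = 2 := by
  obtain ⟨x, hx⟩ := x
  induction x with
  | _ a b =>
    simp only [SimpleGraph.mem_edgeSet, SimpleGraph.top_adj] at hx
    simp [pairIncidence, filter_or, filter_eq', card_pair hx]

theorem pairIncidence_mul_self (x : (⊤ : SimpleGraph (Fin n)).edgeSet) (a : Fin n) :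
    pairIncidence x a * pairIncidence x a = pairIncidence x a := by
  simp [pairIncidence]

theorem sum_pairIncidence_mul_of_ne {a b : Fin n} (h : a ≠ b) :
    ∑ x, pairIncidence x a * pairIncidence x b = 1 := by
  rw [Finset.sum_eq_single (⟨s(a, b), by simpa using h⟩ : (⊤ : SimpleGraph (Fin n)).edgeSet)]
  · simp [pairIncidence]
  · intro x _ hx
    have : ¬ (a ∈ (x : Sym2 (Fin n)) ∧ b ∈ (x : Sym2 (Fin n))) := fun hab =>
      hx (Subtype.ext ((Sym2.mem_and_mem_iff h).1 hab))
    simp only [pairIncidence]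
    grind
  · simp

theorem sum_pairIncidence_mul_self (a : Fin n) :
    ∑ x, pairIncidence x a * pairIncidence x a = n - 1 := by
  -- Double counting: each edge at `a` has two ends, and each of the `n - 1` other vertices shares
  -- one edge with `a`.
  have h1 : ∑ x, ∑ b, pairIncidence x a * pairIncidence x b = 2 * ∑ x, pairIncidence x a := by
    simp_rw [← Finset.mul_sum, sum_pairIncidence, ← Finset.sum_mul, mul_comm]
  rw [Finset.sum_comm, ← Finset.add_sum_erase _ _ (Finset.mem_univ a),
    Finset.sum_congr rfl (g := fun _ => (1 : ℚ))
      fun b hb => sum_pairIncidence_mul_of_ne (Finset.ne_of_mem_erase hb).symm] at h1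
  have hn : 1 ≤ n := a.pos
  simp only [pairIncidence_mul_self, sum_const, card_erase_of_mem (mem_univ a), card_univ,
    Fintype.card_fin, nsmul_eq_mul, mul_one, Nat.cast_sub hn, Nat.cast_one] at h1 ⊢
  linarith

theorem sum_pairIncidence_mul_of_adj {x y : (⊤ : SimpleGraph (Fin n)).edgeSet}
    (h : (coTriangularGraph n).Adj x y) : ∑ a, pairIncidence x a * pairIncidence y a = 0 := by
  rw [coTriangularGraph, SimpleGraph.compl_adj, SimpleGraph.lineGraph_adj_iff_exists] at h
  refine Finset.sum_eq_zero fun a _ => ?_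
  simp only [pairIncidence]
  grind

theorem sum_pairIncidence_mul_of_not_adj {x y : (⊤ : SimpleGraph (Fin n)).edgeSet} (hxy : x ≠ y)
    (h : ¬ (coTriangularGraph n).Adj x y) : ∑ a, pairIncidence x a * pairIncidence y a = 1 := by
  rw [coTriangularGraph, SimpleGraph.compl_adj, SimpleGraph.lineGraph_adj_iff_exists] at h
  have : ∃ v, v ∈ (x : Sym2 (Fin n)) ∧ v ∈ (y : Sym2 (Fin n)) := by tauto
  obtain ⟨v, hx, hy⟩ := this
  rw [Finset.sum_eq_single v]
  · simp [pairIncidence, hx, hy]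
  · intro w _ hw
    have : ¬ (w ∈ (x : Sym2 (Fin n)) ∧ w ∈ (y : Sym2 (Fin n))) := fun hab =>
      hxy (Subtype.ext (((Sym2.mem_and_mem_iff hw).1 ⟨hab.1, hx⟩).trans
        ((Sym2.mem_and_mem_iff hw).1 ⟨hab.2, hy⟩).symm))
    simp only [pairIncidence]
    grind
  · simp

end Pairs

/-! ### Gram matrices of the design and the rational congruence. -/

section Gram

open Finset

theorem sum_mul_sum_mul {α β : Type*} [Fintype α] [Fintype β] {R : Type*} [CommSemiring R]
    (f : α → R) (M : α → β → R) (g : β → R) :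
    ∑ x, f x * ∑ y, M x y * g y = ∑ y, (∑ x, f x * M x y) * g y := by
  simp_rw [Finset.mul_sum, Finset.sum_mul]
  rw [Finset.sum_comm]
  simp_rw [mul_assoc]

theorem card_nsmul_singleton (α : Type*) [Fintype α] {β : Type*} (x : β) :
    Fintype.card α • ({x} : Multiset β) = univ.val.map (fun _ : α => x) := by
  simp [Multiset.nsmul_singleton]

variable {P ι : Type*} [Fintype P] [DecidableEq P] [Fintype ι] {n : ℕ}
  {N : ι → P → ℚ} {S : ι → Fin n → ℚ} {k lam l₁ μ : ℚ}

/-- A 2-design, given by its incidence matrix `N`, whose block intersection numbers are determined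
by the incidence matrix `S` of pairs: parameters and the relation between `N` and `S`. -/
theorem coTriangular_parameters [DecidableEq ι] (hn : 5 ≤ n) (hμ : 1 ≤ μ) (hl₁ : 0 ≤ l₁)
    (hN : ∀ i p, N i p * N i p = N i p) (hk : ∀ i, ∑ p, N i p = k)
    (hlam : ∀ p q, p ≠ q → ∑ i, N i p * N i q = lam)
    (hS : ∀ i a, S i a * S i a = S i a) (hS2 : ∀ i, ∑ a, S i a = 2)
    (hSS : ∀ a b, ∑ i, S i a * S i b = (if a = b then (n : ℚ) - 2 else 0) + 1)
    (hG : ∀ i j, ∑ p, N i p * N j p =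
      l₁ + μ - μ * ∑ a, S i a * S j a + if i = j then k - l₁ + μ else 0)
    (h0 : ∃ i j, i ≠ j ∧ ∑ a, S i a * S j a = 0) (h1 : ∃ i j, i ≠ j ∧ ∑ a, S i a * S j a = 1) :
    ∃ r : ℚ, (∀ p q, ∑ i, N i p * N i q = (if p = q then (n - 2) * μ else 0) + lam) ∧
      (∀ p, ∑ i, N i p = r) ∧ (∀ p a, ∑ i, N i p * S i a = 2 * r / n) ∧
      2 * (Fintype.card P : ℚ) = (n - 1) * (n - 2) ∧
      2 * (Fintype.card ι : ℚ) = n * (n - 1) ∧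
      r * k = (n - 2) * μ + Fintype.card P * lam ∧
      Fintype.card ι * k = Fintype.card P * r := by
  have hn' : (5 : ℚ) ≤ n := by exact_mod_cast hn
  -- `ρ` is the coefficient of the identity in `G`, and `σ` is the factor by which `G` acts on the
  -- columns of `S`, modulo constants.
  obtain ⟨ρ, hρ⟩ : ∃ ρ, ρ = k - l₁ + μ := ⟨_, rfl⟩
  obtain ⟨σ, hσ⟩ : ∃ σ, σ = ρ - μ * (n - 2) := ⟨_, rfl⟩
  obtain ⟨c, hc⟩ : ∃ c, c = (l₁ + μ) * (n - 1) - 2 * μ := ⟨_, rfl⟩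
  have hs : ∀ a, ∑ i, S i a = n - 1 := fun a => by
    have := hSS a a
    simp only [hS, if_true] at this
    linarith
  let G : ι → ι → ℚ := fun i j => ∑ p, N i p * N j p
  let T : ι → ι → ℚ := fun i j => ∑ a, S i a * S j a
  have hGT : ∀ i j, G i j = l₁ + μ - μ * T i j + if i = j then ρ else 0 := by
    intro i j; rw [hρ]; exact hG i j
  have hTS : ∀ i a, ∑ j, T i j * S j a = (n - 2) * S i a + 2 := fun i a => by
    simp only [T]
    rw [← sum_mul_sum_mul]
    simp_rw [hSS, mul_add, Finset.sum_add_distrib]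
    simp [hS2]; ring
  have hTs : ∀ i, ∑ j, T i j = 2 * (n - 1) := fun i => by
    simp only [T]
    rw [Finset.sum_comm]
    simp_rw [← Finset.mul_sum, hs, ← Finset.sum_mul, hS2]
  have hGS : ∀ i a, ∑ j, G i j * S j a = σ * S i a + c := fun i a => by
    simp_rw [hGT, add_mul, sub_mul, Finset.sum_add_distrib, Finset.sum_sub_distrib]
    simp_rw [mul_assoc, ← Finset.mul_sum, hTS]
    simp only [hs, ite_mul, zero_mul, Finset.sum_ite_eq,
      Finset.mem_univ, if_true]
    rw [hσ, hc]; ring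
  have hcard : 2 * (Fintype.card ι : ℚ) = n * (n - 1) := by
    have : ∑ i, ∑ a, S i a = ∑ a, ∑ i, S i a := Finset.sum_comm
    simp only [hS2, hs] at this
    simp only [sum_const, card_univ, nsmul_eq_mul, Fintype.card_fin] at this
    linarith
  obtain ⟨g, hg⟩ : ∃ g, g = (l₁ + μ) * Fintype.card ι - μ * (2 * (n - 1)) + ρ := ⟨_, rfl⟩
  have hGs : ∀ i, ∑ j, G i j = g := fun i => by
    simp_rw [hGT, Finset.sum_add_distrib, Finset.sum_sub_distrib, ← Finset.mul_sum, hTs]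
    simp [hg]; ring
  let w : P → Fin n → ℚ := fun p a => ∑ i, N i p * S i a
  have hww : ∀ a b, ∑ p, w p a * w p b = σ * ((if a = b then (n : ℚ) - 2 else 0) + 1)
      + c * (n - 1) := fun a b => by
    have e1 : ∀ i, ∑ p, N i p * w p b = σ * S i b + c := fun i => by
      rw [← hGS]; simp only [w, G]; rw [sum_mul_sum_mul]
    have e2 : ∑ p, w p a * w p b = ∑ i, S i a * ∑ p, N i p * w p b := by
      rw [sum_mul_sum_mul (fun i => S i a)]; simp only [w, mul_comm]
    rw [e2]
    simp_rw [e1, mul_add, Finset.sum_add_distrib, mul_left_comm _ σ, ← Finset.mul_sum, hSS,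
      ← Finset.sum_mul, hs]
    ring
  have hdiff : ∀ a b, a ≠ b → ∑ p, (w p a - w p b) ^ 2 = 2 * σ * (n - 2) := fun a b hab => by
    have : ∀ p, (w p a - w p b) ^ 2 = w p a * w p a - 2 * (w p a * w p b) + w p b * w p b :=
      fun p => by ring
    simp_rw [this, Finset.sum_add_distrib, Finset.sum_sub_distrib, ← Finset.mul_sum, hww]
    simp [hab]; ring
  -- A sum of squares equals `2σ(n - 2)`. Nonnegativity of `σ` bounds `ρ` below and gives `k > 1`,
  -- which is needed for dividing by `k - 1` to get a constant replication number.
  have hσ0 : 0 ≤ σ := by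
    have h := hdiff ⟨0, by omega⟩ ⟨1, by omega⟩ (by simp)
    have : 0 ≤ 2 * σ * (n - 2) := h ▸ Finset.sum_nonneg fun p _ => sq_nonneg _
    nlinarith
  have hρ0 : 3 ≤ ρ := by nlinarith
  have hk1 : 1 < k := by nlinarith
  have hr : ∀ p, ∑ i, N i p = (Fintype.card P - 1) * lam / (k - 1) := fun p => by
    have e : ∑ i, ∑ q, N i p * N i q = k * ∑ i, N i p := by
      simp_rw [← Finset.mul_sum, hk, ← Finset.sum_mul, mul_comm]
    rw [Finset.sum_comm, ← Finset.add_sum_erase _ _ (Finset.mem_univ p),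
      Finset.sum_congr rfl (g := fun _ => lam)
        fun q hq => hlam p q (Finset.ne_of_mem_erase hq).symm] at e
    have hP : 1 ≤ Fintype.card P := Fintype.card_pos_iff.2 ⟨p⟩
    simp only [hN, sum_const, card_erase_of_mem (mem_univ p), card_univ, nsmul_eq_mul,
      Nat.cast_sub hP, Nat.cast_one] at e
    rw [eq_div_iff (by linarith)]
    linarith
  obtain ⟨r, hrdef⟩ : ∃ r, r = (Fintype.card P - 1) * lam / (k - 1) := ⟨_, rfl⟩
  rw [← hrdef] at hr
  rw [eq_div_iff (by linarith)] at hrdef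
  have hNN : ∀ p q, ∑ i, N i p * N i q = (if p = q then r - lam else 0) + lam := fun p q => by
    split_ifs with h
    · rw [h]; simp [hN, hr]
    · rw [hlam p q h, zero_add]
  have hGN : ∀ i p, ∑ j, G i j * N j p = (r - lam) * N i p + lam * k := fun i p => by
    simp only [G]
    rw [← sum_mul_sum_mul]
    simp_rw [hNN, mul_add, Finset.sum_add_distrib, ← Finset.sum_mul, hk]
    simp; ring
  have hGG : ∀ i l, ∑ j, G i j * G j l = (r - lam) * G i l + lam * k ^ 2 := fun i l => by
    have : ∑ j, G i j * G j l = ∑ p, (∑ j, G i j * N j p) * N l p :=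
      sum_mul_sum_mul (G i) N (N l)
    rw [this]
    simp_rw [hGN, add_mul, Finset.sum_add_distrib, mul_assoc, ← Finset.mul_sum, hk, sq]
    rfl
  have hGG' : ∀ i l, ∑ j, G i j * G j l =
      (l₁ + μ) * g - μ * (σ * T i l + 2 * c) + ρ * G i l := fun i l => by
    have e1 : ∑ j, G i j * T j l = σ * T i l + 2 * c := by
      have : ∑ j, G i j * T j l = ∑ a, (∑ j, G i j * S j a) * S l a :=
        sum_mul_sum_mul (G i) S (S l)
      rw [this]
      simp_rw [hGS, add_mul, Finset.sum_add_distrib, mul_assoc, ← Finset.mul_sum, hS2]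
      ring
    have : ∀ j, G i j * G j l =
        (l₁ + μ) * G i j - μ * (G i j * T j l) + if j = l then ρ * G i j else 0 := fun j => by
      rw [hGT j l]; split_ifs <;> ring
    simp_rw [this, Finset.sum_add_distrib, Finset.sum_sub_distrib, ← Finset.mul_sum, e1, hGs]
    simp
  obtain ⟨i, j, hij, hT0⟩ := h0
  obtain ⟨i', j', hij', hT1⟩ := h1
  have hTd : T i i = 2 := by simp only [T, hS, hS2]
  -- The two expressions for `G²` are compared at a disjoint pair, at a meeting pair and on the
  -- diagonal. The first two differ by `μ(r - lam - σ - ρ)`; then the diagonal and `E0` differ by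
  -- `σρ`, and `ρ > 0`.
  have E0 := (hGG i j).symm.trans (hGG' i j)
  have E1 := (hGG i' j').symm.trans (hGG' i' j')
  have Ed := (hGG i i).symm.trans (hGG' i i)
  rw [hGT, show T i j = 0 from hT0, if_neg hij] at E0
  rw [hGT, show T i' j' = 1 from hT1, if_neg hij'] at E1
  rw [hGT, hTd, if_pos rfl] at Ed
  have hm : r - lam = σ + ρ := by
    have : μ * (r - lam - (σ + ρ)) = 0 := by linear_combination E0 - E1
    rcases mul_eq_zero.1 this with h | h <;> linarith
  have hσz : σ = 0 := by
    rw [hm] at E0 Ed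
    have : σ * ρ = 0 := by linear_combination Ed - E0
    rcases mul_eq_zero.1 this with h | h <;> linarith
  have hρ' : ρ = (n - 2) * μ := by linarith
  have hm' : r - lam = (n - 2) * μ := by rw [hm, hσz, hρ', zero_add]
  have hrk : r * k = (n - 2) * μ + Fintype.card P * lam := by linarith
  have hbk : Fintype.card ι * k = Fintype.card P * r := by
    have : ∑ i, ∑ p, N i p = ∑ p, ∑ i, N i p := Finset.sum_comm
    simpa only [hk, hr, sum_const, card_univ, nsmul_eq_mul] using this
  have hg' : g = r * k := by
    rw [← hGs i]
    simp only [G]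
    rw [Finset.sum_comm]
    simp_rw [← Finset.mul_sum, hr, ← Finset.sum_mul, hk, mul_comm]
  refine ⟨r, fun p q => by rw [hNN, hm'], hr, fun p a => ?_, ?_, hcard, hrk, hbk⟩
  -- With `σ = 0` the sum of squares in `hdiff` vanishes, so `w p` is constant.
  · have hwc : ∀ b, w p b = w p a := fun b => by
      by_cases hab : b = a
      · rw [hab]
      · have := hdiff b a hab
        rw [hσz, mul_zero, zero_mul, Finset.sum_eq_zero_iff_of_nonneg fun p _ => sq_nonneg _] at this
        exact sub_eq_zero.1 (pow_eq_zero_iff two_ne_zero |>.1 (this p (Finset.mem_univ p)))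
    have : ∑ b, w p b = 2 * r := by
      simp only [w]
      rw [Finset.sum_comm]
      simp_rw [← Finset.mul_sum, hS2, ← Finset.sum_mul, hr, mul_comm]
    simp only [hwc, sum_const, card_univ, Fintype.card_fin, nsmul_eq_mul] at this
    rw [eq_div_iff (by linarith), ← this, mul_comm]
  · have hc : ((n : ℚ) - 2) * μ * (2 * Fintype.card P - (n - 1) * (n - 2)) = 0 := by
      -- The trace of `G`: it is `b * k`, and the nonzero eigenvalues are `r * k` once and `r - lam`
      -- with multiplicity `v - 1`.
      have e : (Fintype.card P - 1 : ℚ) * ((n - 2) * μ) =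
          Fintype.card ι * k - ((l₁ + μ) * Fintype.card ι - μ * (2 * (n - 1)) + (n - 2) * μ) := by
        rw [← hρ', ← hg, hg', hbk, hrk, hρ']
        linear_combination (-(Fintype.card P : ℚ)) * hm'
      have hk' : k = l₁ - μ + (n - 2) * μ := by linarith
      rw [hk'] at e
      linear_combination 2 * e + ((n - 2) * μ - 2 * μ) * hcard
    rcases mul_eq_zero.1 hc with h | h
    · rcases mul_eq_zero.1 h with h | h <;> linarith
    · linarith

/-- The rational congruence obtained from a co-triangular design. -/
theorem coTriangular_represents (hn : 5 ≤ n)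
    (hNN : ∀ p q, ∑ i, N i p * N i q = (if p = q then ((n : ℚ) - 2) * μ else 0) + lam)
    (hs : ∀ a, ∑ i, S i a = (n : ℚ) - 1)
    (hSS : ∀ a b, ∑ i, S i a * S i b = (if a = b then (n : ℚ) - 2 else 0) + 1)
    {r : ℚ} (hr : ∀ p, ∑ i, N i p = r) (hNS : ∀ p a, ∑ i, N i p * S i a = 2 * r / n)
    (hv : 2 * (Fintype.card P : ℚ) = (n - 1) * (n - 2))
    (hb : 2 * (Fintype.card ι : ℚ) = n * (n - 1))
    (hrk : r * k = (n - 2) * μ + Fintype.card P * lam)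
    (hbk : Fintype.card ι * k = Fintype.card P * r) :
    Represents (({(Fintype.card ι : ℚ)} + Fintype.card P • {((n : ℚ) - 2) * μ})
        + n • {(n : ℚ) - 2})
      ((Fintype.card ι • {1} + {Fintype.card P * ((n - 2) * μ)}) + {n * ((n : ℚ) - 2)}) := by
  have hn' : (5 : ℚ) ≤ n := by exact_mod_cast hn
  obtain ⟨v, hvdef⟩ : ∃ v : ℚ, v = Fintype.card P := ⟨_, rfl⟩
  obtain ⟨b, hbdef⟩ : ∃ b : ℚ, b = Fintype.card ι := ⟨_, rfl⟩
  rw [← hvdef] at hv hrk hbk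
  rw [← hbdef] at hb hbk
  have hn0 : (n : ℚ) ≠ 0 := by linarith
  have hv0 : v ≠ 0 := by rintro rfl; nlinarith
  have hb0 : b ≠ 0 := by rintro rfl; nlinarith
  have e1 : ∀ x : ℚ, ({x} : Multiset ℚ) = univ.val.map (fun _ : Unit => x) := fun x => by simp
  have e2 : n • ({(n : ℚ) - 2} : Multiset ℚ) = univ.val.map (fun _ : Fin n => (n : ℚ) - 2) := by
    rw [← card_nsmul_singleton, Fintype.card_fin]
  rw [← hvdef, ← hbdef, card_nsmul_singleton, card_nsmul_singleton, e2, e1, e1, e1, ← map_univ_sum_elim, ← map_univ_sum_elim,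
    ← map_univ_sum_elim, ← map_univ_sum_elim, represents_map_univ_iff]
  -- The columns of `N` and `S` are projected off the all-one vector. Each family then has a Gram
  -- matrix that is a scalar matrix minus a multiple of `J`; the extra rows `1 / v` and `1 / n`
  -- supply that multiple.
  let M : (ι ⊕ Unit) ⊕ Unit → (Unit ⊕ P) ⊕ Fin n → ℚ := Sum.elim
    (Sum.elim (fun i => Sum.elim (Sum.elim (fun _ => 1) (fun p => N i p - r / b))
      (fun a => S i a - 2 / n)) (fun _ => Sum.elim (Sum.elim 0 (fun _ => 1 / v)) 0))
      (fun _ => Sum.elim (Sum.elim 0 0) (fun _ => 1 / n))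
  have hNr : ∀ p, ∑ i, (N i p - r / b) = 0 := fun p => by
    rw [Finset.sum_sub_distrib, hr]
    simp only [sum_const, card_univ, nsmul_eq_mul, ← hbdef]
    field_simp; ring
  have hSr : ∀ a, ∑ i, (S i a - 2 / n) = 0 := fun a => by
    rw [Finset.sum_sub_distrib, hs]
    simp only [sum_const, card_univ, nsmul_eq_mul, ← hbdef]
    field_simp; linarith
  have hNSr : ∀ p a, ∑ i, (N i p - r / b) * (S i a - 2 / n) = 0 := fun p a => by
    simp_rw [mul_sub, Finset.sum_sub_distrib, ← Finset.sum_mul, hNr, sub_mul,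
      Finset.sum_sub_distrib, hNS, ← Finset.mul_sum, hs]
    field_simp; linear_combination r * hb
  have hNNr : ∀ p q, ∑ i, (N i p - r / b) * (N i q - r / b) + (v * ((n - 2) * μ)) * (1 / v * (1 / v))
      = if p = q then (n - 2) * μ else 0 := fun p q => by
    simp_rw [mul_sub, Finset.sum_sub_distrib, ← Finset.sum_mul, hNr, sub_mul,
      Finset.sum_sub_distrib, hNN, ← Finset.mul_sum, hr]
    have : r / b * r = lam + (n - 2) * μ / v := by
      field_simp
      linear_combination b * hrk - r * hbk
    rw [this]
    field_simp; ring
  have hSSr : ∀ a a', ∑ i, (S i a - 2 / n) * (S i a' - 2 / n) + (n * ((n : ℚ) - 2)) *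
      (1 / n * (1 / n)) = if a = a' then (n : ℚ) - 2 else 0 := fun a a' => by
    simp_rw [mul_sub, Finset.sum_sub_distrib, ← Finset.sum_mul, hSr, sub_mul,
      Finset.sum_sub_distrib, hSS, ← Finset.mul_sum, hs]
    field_simp; ring
  refine DiagRep.of_columns M fun x y => ?_
  simp only [Fintype.sum_sum_type, M, Finset.univ_unique, Finset.sum_singleton, Sum.elim_inl,
    Sum.elim_inr, one_mul]
  rcases x with (x | p) | a <;> rcases y with (y | q) | a' <;>
    simp [hNr, hSr, ← hbdef, hNSr]
  · simpa using hNNr p q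
  · simp_rw [mul_comm (S _ a - _), hNSr]
  · simpa using hSSr a a'

end Gram

/-! ### Simplifying the congruence. -/

theorem Represents.cancel' {K : Type*} [Field K] [CharZero K] {s t s' t' : Multiset K}
    (u : Multiset K) (h : Represents s' t') (hs : s' = s + u) (ht : t' = t + u) :
    Represents s t :=
  Represents.cancel two_ne_zero u (hs ▸ ht ▸ h)

theorem Represents.scale_pair {K : Type*} [Field K] {a b c d a' b' c' d' : K} (s x y z w : K)
    (h : Represents ({a} + {b} : Multiset K) ({c} + {d}))
    (ha : a' = s * a * x ^ 2) (hb : b' = s * b * y ^ 2)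
    (hc : s * c = c' * z ^ 2) (hd : s * d = d' * w ^ 2) :
    Represents ({a'} + {b'} : Multiset K) ({c'} + {d'}) := by
  have := h.scale s
  simp only [Multiset.map_add, Multiset.map_singleton] at this
  exact (((of_eq_mul_sq ha).add (of_eq_mul_sq hb)).trans this).trans
    ((of_eq_mul_sq hc).add (of_eq_mul_sq hd))

/-- The congruence of a co-triangular design, with `n = c + 2`, simplified. -/
theorem IsCoTriangularDesign.represents_rat {P ι : Type*} [Fintype P] [DecidableEq P] [Fintype ι]
    {c μ : ℕ} (hc : 3 ≤ c) (hμ : 1 ≤ μ) {B : ι → Finset P}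
    (hB : IsCoTriangularDesign B (c + 2) μ) :
    ∃ v : ℕ, 2 * v = (c + 1) * c ∧
      Represents ({2 * ((c : ℚ) + 1)} + {2} + v • {(c : ℚ) * μ} + (c + 2) • {(c : ℚ)})
        ((v + c + 2) • {1} + {2 * ((c : ℚ) + 1) * μ} + {2 * (c : ℚ)}) := by
  classical
  obtain ⟨l₁, l₂, ⟨⟨v, k, lam, -, hk, hlam⟩, hl, hint⟩, rfl, ⟨φ⟩⟩ := hB
  let N : ι → P → ℚ := fun i p => if p ∈ B i then 1 else 0
  let S : ι → Fin (c + 2) → ℚ := fun i a => pairIncidence (φ i) a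
  have hNN : ∀ i j, ∑ p, N i p * N j p = ((B i ∩ B j).card : ℚ) := fun i j => by
    simp only [N, ← ite_and, ite_mul, one_mul, zero_mul, ← Finset.mem_inter]
    rw [Finset.sum_boole, Finset.filter_univ_mem]
  have hSadj : ∀ i j, i ≠ j → (B i ∩ B j).card = l₁ + μ → ∑ a, S i a * S j a = 0 :=
    fun i j hij h => sum_pairIncidence_mul_of_adj (φ.map_adj_iff.2 ⟨hij, h⟩)
  have hSnadj : ∀ i j, i ≠ j → (B i ∩ B j).card = l₁ → ∑ a, S i a * S j a = 1 :=
    fun i j hij h => sum_pairIncidence_mul_of_not_adj (fun e => hij (φ.injective e))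
      fun hadj => by
        have := (φ.map_adj_iff.1 hadj).2
        omega
  have hS : ∀ i a, S i a * S i a = S i a := fun i a => pairIncidence_mul_self _ _
  have hS2 : ∀ i, ∑ a, S i a = 2 := fun i => sum_pairIncidence _
  have hSS : ∀ a b, ∑ i, S i a * S i b =
      (if a = b then ((c + 2 : ℕ) : ℚ) - 2 else 0) + 1 := fun a b => by
    have : ∑ i, S i a * S i b = ∑ x, pairIncidence x a * pairIncidence x b :=
      φ.toEquiv.sum_comp fun x => pairIncidence x a * pairIncidence x b
    rw [this]
    split_ifs with h
    · rw [h, sum_pairIncidence_mul_self]; ring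
    · rw [sum_pairIncidence_mul_of_ne h, zero_add]
  have hs : ∀ a, ∑ i, S i a = ((c + 2 : ℕ) : ℚ) - 1 := fun a => by
    have := hSS a a
    simp only [hS, if_true] at this
    linarith
  have hmem : ∀ x, x ∈ intersectionNumbers B ↔ x = l₁ ∨ x = l₁ + μ := fun x => by
    rw [hint]; simp
  have hlam' : ∀ p q, p ≠ q → ∑ i, N i p * N i q = (lam : ℚ) := fun p q hpq => by
    rw [← hlam p q hpq]
    simp only [N, ← ite_and, ite_mul, one_mul, zero_mul]
    simp
  have hG : ∀ i j, ∑ p, N i p * N j p =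
      l₁ + μ - μ * ∑ a, S i a * S j a + if i = j then (k : ℚ) - l₁ + μ else 0 := fun i j => by
    rw [hNN]
    split_ifs with h
    · rw [h, Finset.inter_self, hk]; simp only [hS, hS2]; ring
    · rcases (hmem _).1 ⟨i, j, h, rfl⟩ with h' | h'
      · rw [hSnadj i j h h', h']; ring
      · rw [hSadj i j h h', h']; push_cast; ring
  have hk' : ∀ i, ∑ p, N i p = (k : ℚ) := fun i => by rw [← hk i]; simp [N]
  obtain ⟨i₁, j₁, hij₁, h₁⟩ := (hmem l₁).2 (Or.inl rfl)
  obtain ⟨i₂, j₂, hij₂, h₂⟩ := (hmem (l₁ + μ)).2 (Or.inr rfl)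
  obtain ⟨r, hNN', hr, hNS, hv, hb, hrk, hbk⟩ := coTriangular_parameters (n := c + 2) (N := N)
    (S := S) (k := k) (lam := lam) (l₁ := l₁) (μ := μ) (by omega) (by exact_mod_cast hμ)
    (by positivity) (fun i p => by simp [N]) hk' hlam' hS hS2 hSS hG
    ⟨i₂, j₂, hij₂, hSadj _ _ hij₂ h₂⟩ ⟨i₁, j₁, hij₁, hSnadj _ _ hij₁ h₁⟩
  have R := coTriangular_represents (by omega) hNN' hs hSS hr hNS hv hb hrk hbk
  have hcc : ((c + 2 : ℕ) : ℚ) - 2 = c := by push_cast; ring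
  rw [hcc] at R hv
  push_cast at hv hb
  have hv2 : 2 * (Fintype.card P : ℚ) = (c + 1) * c := by rw [hv]; ring
  have hbv : Fintype.card ι = Fintype.card P + c + 1 := by
    have : (Fintype.card ι : ℚ) = Fintype.card P + c + 1 := by linarith
    exact_mod_cast this
  have hc0 : (c : ℚ) ≠ 0 := by
    have : c ≠ 0 := by omega
    exact_mod_cast this
  refine ⟨Fintype.card P, by exact_mod_cast hv2, ?_⟩
  -- `L1` to `L3` remove the dependence on `b` and the factors `v` and `n`, using `2(c+1) + 2 =
  -- 2(c+2)`, `16b = 8(c+1)(c+2)`, `2v = (c+1)c` and `c² + 2c = c(c+2)`. A term `⟨2(c+2)⟩` is added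
  -- on both sides for `L3`.
  have L1 : Represents ({2 * ((c : ℚ) + 1)} + {2}) ({2 * ((c : ℚ) + 2)} + {(Fintype.card ι : ℚ)}) :=
    (Represents.pair' (s := 2 * ((c : ℚ) + 2)) 1 1 (by ring) (by positivity)).trans
      ((Represents.refl _).add (Represents.of_eq_mul_sq (t := 4) (by linear_combination (-8) * hb)))
  have L2 : Represents ({(Fintype.card P : ℚ) * (c * μ)}) ({2 * ((c : ℚ) + 1) * μ}) :=
    Represents.of_eq_mul_sq (t := (c : ℚ) / 2) (by linear_combination (c * μ / 2 : ℚ) * hv2)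
  have L3 : Represents ({((c + 2 : ℕ) : ℚ) * c} + {2 * ((c : ℚ) + 2)}) ({1} + {2 * (c : ℚ)}) :=
    ((Represents.refl _).add (Represents.of_eq_mul_sq (t := 1 / (c : ℚ))
      (by push_cast; field_simp))).trans (Represents.pair (c : ℚ) 1 (by push_cast; ring))
  have R1 := L1.add (Represents.refl
    (Fintype.card P • {(c : ℚ) * μ} + (c + 2) • {(c : ℚ)} : Multiset ℚ))
  have R2 := (((Represents.refl (Fintype.card ι • {(1 : ℚ)})).add L2).add L3)
  have R3 := R.add (Represents.refl ({2 * ((c : ℚ) + 2)}))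
  have R4 := (R1.trans (by convert R3 using 1; abel)).trans (by convert R2 using 1; abel)
  convert R4 using 1
  · abel
  · rw [hbv, show Fintype.card P + c + 2 = Fintype.card P + c + 1 + 1 by ring, succ_nsmul _ (_ + 1)]
    abel

theorem IsCoTriangularDesign.represents (K : Type*) [Field K] [CharZero K] {P ι : Type*}
    [Fintype P] [DecidableEq P] [Fintype ι] {c μ : ℕ} (hc : 3 ≤ c) (hμ : 1 ≤ μ) {B : ι → Finset P}
    (hB : IsCoTriangularDesign B (c + 2) μ) {v : ℕ} (hv : 2 * v = (c + 1) * c) :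
    Represents ({2 * ((c : K) + 1)} + {2} + v • {(c : K) * μ} + (c + 2) • {(c : K)})
      ((v + c + 2) • {1} + {2 * ((c : K) + 1) * μ} + {2 * (c : K)}) := by
  obtain ⟨w, hw, h⟩ := hB.represents_rat hc hμ
  obtain rfl : w = v := by omega
  have := h.map (Rat.castHom K) two_ne_zero
  simpa [Multiset.map_add, Multiset.map_nsmul] using this

/-! ### Isotropy of ternary forms through binary forms. -/

section Isotropy

variable {K : Type*} [Field K]

/-- The form `⟨a, b, -1⟩` is isotropic over the field `K`. -/
def TernaryIsotropic (a b : K) : Prop :=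
  ∃ x y z : K, (x, y, z) ≠ (0, 0, 0) ∧ a * x ^ 2 + b * y ^ 2 = z ^ 2

theorem TernaryIsotropic.of_one {a b : K} (h : ∃ x y, 1 = a * x ^ 2 + b * y ^ 2) :
    TernaryIsotropic a b := by
  obtain ⟨x, y, h⟩ := h
  exact ⟨x, y, 1, by simp, by rw [← h]; ring⟩

theorem TernaryIsotropic.of_sub {a b : K} (h : ∃ x y, a = b * x ^ 2 + 1 * y ^ 2) :
    TernaryIsotropic a (-b) := by
  obtain ⟨x, y, h⟩ := h
  exact ⟨1, x, y, by simp, by rw [h]; ring⟩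

theorem TernaryIsotropic.mul_sq_iff {a b t : K} (ht : t ≠ 0) :
    TernaryIsotropic a (b * t ^ 2) ↔ TernaryIsotropic a b := by
  constructor
  · rintro ⟨x, y, z, h, e⟩
    refine ⟨x, t * y, z, ?_, by rw [← e]; ring⟩
    simpa [Prod.ext_iff, ht] using h
  · rintro ⟨x, y, z, h, e⟩
    refine ⟨x, y / t, z, ?_, by rw [← e]; field_simp⟩
    simpa [Prod.ext_iff, ht] using h

variable [CharZero K]

theorem TernaryIsotropic.exists_one {a b : K} (ha : a ≠ 0) (hb : b ≠ 0)
    (h : TernaryIsotropic a b) : ∃ x y, 1 = a * x ^ 2 + b * y ^ 2 := by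
  obtain ⟨x, y, z, h, e⟩ := h
  by_cases hz : z = 0
  · have hx : x ≠ 0 := by
      rintro rfl
      subst hz
      have : y ≠ 0 := by simpa [Prod.ext_iff] using h
      simp [hb, this] at e
    -- Here `⟨a, b⟩` is itself isotropic, hence hyperbolic and universal: `u = ((u/w + 1)² - (u/w -
    -- 1)²) * w / 4` with `u = 1` and `w = a * x ^ 2`.
    refine ⟨x * (1 + 1 / (a * x ^ 2)) / 2, y * (1 - 1 / (a * x ^ 2)) / 2, ?_⟩
    have : b * y ^ 2 = - (a * x ^ 2) := by rw [hz] at e; linear_combination e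
    have e2 : b * (y * (1 - 1 / (a * x ^ 2)) / 2) ^ 2 =
        - (a * x ^ 2) * (1 - 1 / (a * x ^ 2)) ^ 2 / 4 := by rw [← this]; ring
    rw [e2]
    field_simp
    ring
  · exact ⟨x / z, y / z, by field_simp; exact e.symm⟩

theorem TernaryIsotropic.exists_sub {a b : K} (hb : b ≠ 0)
    (h : TernaryIsotropic a (-b)) : ∃ x y, a = b * x ^ 2 + 1 * y ^ 2 := by
  obtain ⟨x, y, z, h, e⟩ := h
  by_cases hx : x = 0
  · have hz : z ≠ 0 := by
      rintro rfl
      subst hx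
      have : y ≠ 0 := by simpa [Prod.ext_iff] using h
      simp [hb, this] at e
    refine ⟨y * (1 - a / z ^ 2) / 2, z * (1 + a / z ^ 2) / 2, ?_⟩
    have : b * y ^ 2 = - z ^ 2 := by rw [hx] at e; linear_combination -e
    have e2 : b * (y * (1 - a / z ^ 2) / 2) ^ 2 = - z ^ 2 * (1 - a / z ^ 2) ^ 2 / 4 := by
      rw [← this]; ring
    rw [e2]
    field_simp
    ring
  · exact ⟨y / x, z / x, by field_simp; linear_combination e⟩

theorem ternaryIsotropic_iff {a b : K} (ha : a ≠ 0) (hb : b ≠ 0) :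
    TernaryIsotropic a b ↔ Represents ({1} + {a * b} : Multiset K) ({a} + {b}) := by
  constructor
  · intro h
    obtain ⟨x, y, h⟩ := h.exists_one ha hb
    simpa using Represents.pair x y h
  · intro h
    exact .of_one (h.exists_of_pair two_ne_zero)

/-- Scaling by `a` exchanges `⟨a, b⟩` and `⟨1, ab⟩` up to squares, so the direction of the
representation can be reversed. -/
theorem ternaryIsotropic_iff' {a b : K} (ha : a ≠ 0) (hb : b ≠ 0) :
    TernaryIsotropic a b ↔ Represents ({a} + {b} : Multiset K) ({1} + {a * b}) := by
  rw [ternaryIsotropic_iff ha hb]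
  constructor <;> intro h
  · exact h.scale_pair a 1 (1 / a) a 1 (by ring) (by field_simp) (by ring) (by ring)
  · exact h.scale_pair a (1 / a) 1 1 a (by field_simp) (by ring) (by ring) (by ring)

theorem ternaryIsotropic_neg_iff {a b : K} (hb : b ≠ 0) :
    TernaryIsotropic a (-b) ↔ Represents ({a} + {a * b} : Multiset K) ({b} + {1}) := by
  constructor
  · intro h
    obtain ⟨x, y, h⟩ := h.exists_sub hb
    have := Represents.pair x y h
    rwa [mul_one, mul_comm b] at this
  · intro h
    exact .of_sub (h.exists_of_pair two_ne_zero)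

theorem ternaryIsotropic_neg_iff' {a b : K} (ha : a ≠ 0) (hb : b ≠ 0) :
    TernaryIsotropic a (-b) ↔ Represents ({b} + {1} : Multiset K) ({a} + {a * b}) := by
  rw [ternaryIsotropic_neg_iff hb, add_comm ({a} : Multiset K) {a * b}]
  constructor <;> intro h
  · exact h.scale_pair a (1 / a) (1 / a) 1 1 (by field_simp) (by field_simp) (by ring) (by ring)
  · exact h.scale_pair a 1 1 a a (by ring) (by ring) (by ring) (by ring)

end Isotropy

theorem Represents.four_mul {K : Type*} [Field K] [CharZero K] {a : ℕ} (ha : a ≠ 0) (w : ℕ) :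
    Represents ((4 * w) • {(a : K)}) ((4 * w) • {1}) ∧
      Represents ((4 * w) • {1}) ((4 * w) • {(a : K)}) := by
  rw [mul_nsmul, mul_nsmul]
  exact ⟨(four_squares ha).1.nsmul w, (four_squares ha).2.nsmul w⟩

/-! ### From rational to integral solutions. -/

theorem isSquare_of_mul_sq_eq {x : ℕ} {s t : ℚ} (hs : s ≠ 0) (h : x * s ^ 2 = t ^ 2) :
    IsSquare x := by
  rw [← Rat.isSquare_natCast_iff]
  exact ⟨t / s, by field_simp; exact h⟩

theorem TernaryIsotropic.hasNontrivialSolution {a b : ℤ}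
    (h : TernaryIsotropic (a : ℚ) (b : ℚ)) : HasNontrivialSolution a b := by
  obtain ⟨x, y, z, h, e⟩ := h
  have hx : (x.den : ℚ) ≠ 0 := by exact_mod_cast x.den_ne_zero
  have hy : (y.den : ℚ) ≠ 0 := by exact_mod_cast y.den_ne_zero
  have hz : (z.den : ℚ) ≠ 0 := by exact_mod_cast z.den_ne_zero
  refine ⟨x.num * y.den * z.den, y.num * x.den * z.den, z.num * x.den * y.den, ?_, ?_⟩
  · simpa [Prod.ext_iff] using h
  · have : ∀ q : ℚ, (q.num : ℚ) = q * q.den := fun q => (Rat.mul_den_eq_num q).symm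
    rw [← Int.cast_inj (α := ℚ)]
    push_cast
    rw [this x, this y, this z]
    linear_combination ((x.den : ℚ) * y.den * z.den) ^ 2 * e

/-- Clearing denominators multiplies `n` by a square, which preserves the parity of the valuations
at primes congruent to 3 modulo 4. -/
theorem Nat.exists_sq_add_sq_of_rat {n : ℕ} {x y : ℚ} (h : (n : ℚ) = x ^ 2 + y ^ 2) :
    ∃ x y : ℕ, n = x ^ 2 + y ^ 2 := by
  rcases Nat.eq_zero_or_pos n with rfl | hn
  · exact ⟨0, 0, rfl⟩
  have hx : (x.den : ℚ) ≠ 0 := by exact_mod_cast x.den_ne_zero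
  have hy : (y.den : ℚ) ≠ 0 := by exact_mod_cast y.den_ne_zero
  have e : n * (x.den * y.den) ^ 2 = (x.num.natAbs * y.den) ^ 2 + (y.num.natAbs * x.den) ^ 2 := by
    have : ∀ q : ℚ, (q.num : ℚ) = q * q.den := fun q => (Rat.mul_den_eq_num q).symm
    rw [← Nat.cast_inj (R := ℚ)]
    push_cast
    simp only [Nat.cast_natAbs, mul_pow, ← Int.cast_pow, sq_abs]
    push_cast
    rw [this x, this y, h]
    ring
  have h1 := Nat.eq_sq_add_sq_iff.1 ⟨_, _, e⟩
  refine Nat.eq_sq_add_sq_iff.2 fun q hq h3 => ?_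
  have hqp : q.Prime := Nat.prime_of_mem_primeFactors hq
  have : Fact q.Prime := ⟨hqp⟩
  have hd : x.den * y.den ≠ 0 := mul_ne_zero x.den_ne_zero y.den_ne_zero
  have hmem : q ∈ (n * (x.den * y.den) ^ 2).primeFactors := by
    rw [Nat.mem_primeFactors] at hq ⊢
    exact ⟨hq.1, hq.2.1.mul_right _, mul_ne_zero hq.2.2 (pow_ne_zero 2 hd)⟩
  have h2 := h1 q hmem h3
  rw [padicValNat.mul hn.ne' (pow_ne_zero 2 hd), padicValNat.pow] at h2
  exact (Nat.even_add.1 h2).2 (even_two_mul _)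

theorem two_mul_choose_two (c : ℕ) : 2 * (c + 1).choose 2 = (c + 1) * c := by
  rw [Nat.choose_two_right, Nat.add_sub_cancel,
    Nat.mul_div_cancel' (even_iff_two_dvd.1 (by rw [mul_comm]; exact Nat.even_mul_succ_self c))]

/-! ### Consequences for the residue classes of `n` modulo 4. -/

section Cases

variable {c μ v : ℕ}

theorem Represents.exists_sq_of_coTriangular (hc : c ≠ 0)
    (h : Represents ({2 * ((c : ℚ) + 1)} + {2} + v • {(c : ℚ) * μ} + (c + 2) • {(c : ℚ)})
      ((v + c + 2) • {1} + {2 * ((c : ℚ) + 1) * μ} + {2 * (c : ℚ)})) :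
    ∃ t : ℚ, ((c : ℚ) * μ) ^ v * c ^ (c + 1) = t ^ 2 * μ := by
  obtain ⟨t, ht⟩ := h.exists_prod_eq two_ne_zero (by simp; ring)
  refine ⟨t, ?_⟩
  have hc' : (c : ℚ) ≠ 0 := by exact_mod_cast hc
  have h1 : (c : ℚ) + 1 ≠ 0 := by positivity
  simp only [Multiset.prod_add, Multiset.prod_nsmul, Multiset.prod_singleton, one_pow] at ht
  have : (4 * ((c : ℚ) + 1) * c) * (((c : ℚ) * μ) ^ v * c ^ (c + 1)) =
      (4 * ((c : ℚ) + 1) * c) * (t ^ 2 * μ) := by linear_combination ht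
  exact mul_left_cancel₀ (by positivity) this

variable {K : Type*} [Field K]

theorem represents_sq_mul {a b d : K} (h : b = d ^ 2) :
    Represents ({a * b} : Multiset K) {a} :=
  Represents.of_eq_mul_sq (by rw [h])

theorem represents_mul_sq {a b d : K} (hd : d ≠ 0) (h : b = d ^ 2) :
    Represents ({a} : Multiset K) {a * b} :=
  Represents.of_eq_mul_sq (t := 1 / d) (by rw [h]; field_simp)

variable [CharZero K]

/-- For (b2). As `μ` is a square, `e` cancels and the coefficients `c` gather into `v + c + 2`
copies. Modulo four copies one or three remain, giving `⟨c, 2⟩ → ⟨1, 2c⟩` or `⟨2, 1⟩ → ⟨c, 2c⟩`;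
hence the sign. -/
theorem ternaryIsotropic_of_represents_one (hc : c ≠ 0) {e d : K} (hd : d ≠ 0)
    (hμ : (μ : K) = d ^ 2) {m j : ℕ} (hv : v + c + 2 = 4 * j + if Even m then 1 else 3)
    (h : Represents ({e} + {2} + v • {(c : K) * μ} + (c + 2) • {(c : K)})
      ((v + c + 2) • {1} + {e * (μ : K)} + {2 * (c : K)})) :
    TernaryIsotropic (c : K) ((-1) ^ m * 2) := by
  have hc' : (c : K) ≠ 0 := by exact_mod_cast hc
  have h3 := (((Represents.refl ({e} + {2})).add ((represents_mul_sq (a := (c : K)) hd hμ).nsmul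
    v)).add (.refl _)).trans
    (h.trans (((Represents.refl _).add (represents_sq_mul hμ)).add (.refl _)))
  have h4 : Represents ({2} + (v + c + 2) • {(c : K)}) ((v + c + 2) • {1} + {2 * (c : K)}) :=
    h3.cancel' {e} (by rw [add_assoc v, add_nsmul _ v]; abel) (by abel)
  rw [hv, add_nsmul, add_nsmul] at h4
  have h5 := (Represents.four_mul (K := K) hc j).2
  split_ifs at h4 with hm
  · have h6 := ((h5.add (.refl ({2} + {(c : K)}))).trans (by convert h4 using 1; abel)).cancel'
      (s := {(c : K)} + {2}) (t := {1} + {(c : K) * 2}) ((4 * j) • {1}) (by abel)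
      (by rw [mul_comm (c : K)]; abel)
    rw [hm.neg_one_pow, one_mul, ternaryIsotropic_iff' hc' two_ne_zero]
    exact h6
  · have h6 := ((h5.add (.refl ({2} + 3 • {(c : K)}))).trans
      (by convert h4 using 1; abel)).cancel'
      (s := {2} + 3 • {(c : K)}) (t := 3 • {1} + {2 * (c : K)}) ((4 * j) • {1}) (by abel)
      (by abel)
    -- A fourth `⟨c⟩` is added on both sides so that `4⟨c⟩` can be exchanged for `4⟨1⟩`.
    have h7 := ((Represents.four_squares (K := K) hc).2.add (.refl {2})).trans
      (by convert h6.add (.refl {(c : K)}) using 1; abel)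
    rw [(Nat.not_even_iff_odd.1 hm).neg_one_pow, neg_one_mul,
      ternaryIsotropic_neg_iff' hc' two_ne_zero, mul_comm (c : K)]
    exact h7.cancel' (3 • {1}) (by abel) (by abel)

/-- For (b4). As `c` is a square, what remains is `⟨e⟩ + v⟨μ⟩ → v⟨1⟩ + ⟨eμ⟩`, reduced modulo four
copies. -/
theorem ternaryIsotropic_of_represents_three (hμ : μ ≠ 0) {e d : K} (he : e ≠ 0) (hd : d ≠ 0)
    (hc : (c : K) = d ^ 2) {m j : ℕ} (hv : v = 4 * j + if Even m then 1 else 3)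
    (h : Represents ({e} + {2} + v • {(c : K) * μ} + (c + 2) • {(c : K)})
      ((v + c + 2) • {1} + {e * (μ : K)} + {2 * (c : K)})) :
    TernaryIsotropic (μ : K) ((-1) ^ m * e) := by
  have hμ' : (μ : K) ≠ 0 := by exact_mod_cast hμ
  have h1 : Represents ({1} : Multiset K) {(c : K)} := by
    simpa using represents_mul_sq (a := 1) hd hc
  have h2 : Represents ({(μ : K)} : Multiset K) {(c : K) * μ} := by
    simpa [mul_comm] using represents_mul_sq (a := (μ : K)) hd hc
  have h3 := (((Represents.refl ({e} + {2})).add (h2.nsmul v)).add (h1.nsmul (c + 2))).trans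
    (h.trans ((Represents.refl _).add (represents_sq_mul hc)))
  have h4 : Represents ({e} + v • {(μ : K)}) (v • {1} + {e * (μ : K)}) :=
    h3.cancel' ({2} + (c + 2) • {1}) (by abel) (by rw [add_assoc v, add_nsmul _ v]; abel)
  rw [hv, add_nsmul, add_nsmul] at h4
  have h5 := (Represents.four_mul (K := K) hμ j).2
  split_ifs at h4 with hm
  · rw [hm.neg_one_pow, one_mul, ternaryIsotropic_iff' hμ' he, mul_comm]
    exact ((h5.add (.refl ({e} + {(μ : K)}))).trans (by convert h4 using 1; abel)).cancel'
      ((4 * j) • {1}) (by abel) (by abel)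
  · have h6 := ((h5.add (.refl ({e} + 3 • {(μ : K)}))).trans
      (by convert h4 using 1; abel)).cancel'
      (s := {e} + 3 • {(μ : K)}) (t := 3 • {1} + {e * (μ : K)}) ((4 * j) • {1}) (by abel)
      (by abel)
    have h7 := ((Represents.four_squares (K := K) hμ).2.add (.refl {e})).trans
      (by convert h6.add (.refl {(μ : K)}) using 1; abel)
    rw [(Nat.not_even_iff_odd.1 hm).neg_one_pow, neg_one_mul,
      ternaryIsotropic_neg_iff' hμ' he, mul_comm (μ : K)]
    exact h7.cancel' (3 • {1}) (by abel) (by abel)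

/-- For (b3). Cancellation gives `⟨e, 2c⟩ → ⟨ec, 2⟩`; since `e = 2 + 2c` is a value of `⟨2, 2c⟩`,
adding `⟨e⟩` turns this into `⟨e, e⟩ → ⟨2, 2⟩`. -/
theorem exists_eq_two_mul_sq_add_sq (hc : c ≠ 0) {e d : K} (he : e = 2 * (c + 1)) (hd : d ≠ 0)
    (hcμ : (c : K) * μ = d ^ 2) {j : ℕ} (hj : c = 4 * j)
    (h : Represents ({e} + {2} + v • {(c : K) * μ} + (c + 2) • {(c : K)})
      ((v + c + 2) • {1} + {e * (μ : K)} + {2 * (c : K)})) :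
    ∃ x y, e = 2 * x ^ 2 + 2 * y ^ 2 := by
  have hc' : (c : K) ≠ 0 := by exact_mod_cast hc
  have h1 : Represents ({1} : Multiset K) {(c : K) * μ} := by
    simpa using represents_mul_sq (a := 1) hd hcμ
  have h2 : Represents ({e * μ} : Multiset K) {e * c} :=
    .of_eq_mul_sq (t := d / c) (by field_simp; linear_combination e * hcμ)
  have h3 : Represents (2 • {2 * (c : K)}) (2 • {(c : K)}) := by
    have := Represents.pair (a := (c : K)) (b := c) (s := 2 * c) 1 1 (by ring)
    rw [two_nsmul, two_nsmul]
    exact ((Represents.refl _).add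
      (.of_eq_mul_sq (t := 1 / (c : K)) (by field_simp))).trans this
  have h4 : Represents (2 • {(1 : K)}) (2 • {2}) := by
    have := Represents.pair (a := (2 : K)) (b := 2) (s := 1) (1 / 2) (1 / 2) (by ring)
    rw [two_nsmul, two_nsmul]
    exact ((Represents.refl _).add
      (.of_eq_mul_sq (t := 1 / 2) (by norm_num))).trans this
  have h5 : Represents ({e} + {e * (c : K)}) ({2} + {2 * (c : K)}) :=
    ((Represents.refl _).add (.of_eq_mul_sq (t := 1 / 2) (by ring))).trans
      (Represents.pair (s := e) 1 1 (by rw [he]; ring))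
  have h6 := (((Represents.refl ({e} + {2})).add (h1.nsmul v)).add (Represents.refl _)).trans
    (h.trans (((Represents.refl _).add h2).add (.refl _)))
  have h7 : Represents ({e} + {2} + (c + 2) • {(c : K)})
      ((c + 2) • {1} + {e * (c : K)} + {2 * (c : K)}) :=
    h6.cancel' (v • {1}) (by abel) (by rw [add_assoc v, add_nsmul _ v]; abel)
  have h8 := (Represents.four_mul (K := K) hc j).2
  rw [← hj] at h8
  have h9 : Represents ({e} + {2 * (c : K)}) ({e * (c : K)} + {2}) := by
    have := (((Represents.refl ({e} + {2})).add (h8.add h3)).trans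
      (by convert h7 using 1; rw [add_nsmul])).trans
      (by convert ((Represents.refl (c • {(1 : K)})).add h4).add
            (.refl ({e * (c : K)} + {2 * (c : K)})) using 1
          rw [add_nsmul]; abel)
    exact this.cancel' (c • {1} + {2} + {2 * (c : K)}) (by abel) (by abel)
  have h10 : Represents ({e} + {e}) ({2} + {2}) :=
    ((h9.add (.refl {e})).trans
      (by convert h5.add (.refl {2}) using 1; abel)).cancel' {2 * (c : K)} (by abel) (by abel)
  exact h10.exists_of_pair two_ne_zero

/-- For (b1). Three-dimensional forms remain, such as `⟨e, 2, cμ⟩ → ⟨1, eμ, 2c⟩`. Either isotropy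
condition matches up a binary part, and cancelling that part leaves the other condition. -/
theorem ternaryIsotropic_iff_of_represents (hc : c ≠ 0) (hμ : μ ≠ 0) {e : K} (he : e ≠ 0)
    {m j i : ℕ} (hv : v = 4 * j + if Even m then 1 else 3) (hi : c + 2 = 4 * i)
    (h : Represents ({e} + {2} + v • {(c : K) * μ} + (c + 2) • {(c : K)})
      ((v + c + 2) • {1} + {e * (μ : K)} + {2 * (c : K)})) :
    TernaryIsotropic (μ : K) ((-1) ^ m * (e * c)) ↔ TernaryIsotropic (c : K) ((-1) ^ m * 2) := by
  have hμ' : (μ : K) ≠ 0 := by exact_mod_cast hμ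
  have hc' : (c : K) ≠ 0 := by exact_mod_cast hc
  have h1 := (Represents.four_mul (K := K) hc i).2
  rw [← hi] at h1
  have h2 : Represents ({e} + {2} + v • {(c : K) * μ}) (v • {1} + {e * (μ : K)} + {2 * (c : K)}) :=
    (((Represents.refl _).add h1).trans h).cancel' ((c + 2) • {1}) rfl
      (by rw [add_assoc v, add_nsmul _ v]; abel)
  rw [hv, add_nsmul, add_nsmul] at h2
  have hcμ : c * μ ≠ 0 := mul_ne_zero hc hμ
  have h3 := (Represents.four_mul (K := K) hcμ j).2
  have h4 := (Represents.four_squares (K := K) hcμ).2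
  rw [Nat.cast_mul] at h3 h4
  split_ifs at h2 with hm
  · have R : Represents ({e} + {2} + {(c : K) * μ}) ({1} + {e * (μ : K)} + {2 * (c : K)}) :=
      ((h3.add (.refl ({e} + {2} + {(c : K) * μ}))).trans (by convert h2 using 1; abel)).cancel'
        ((4 * j) • {1}) (by abel) (by abel)
    rw [hm.neg_one_pow, one_mul, one_mul]
    constructor <;> intro H
    · rw [ternaryIsotropic_iff' hμ' (mul_ne_zero he hc')] at H
      have H2 : Represents ({e * μ} + {(c : K)}) ({e} + {(c : K) * μ}) :=
        H.scale_pair e 1 (1 / e) 1 e (by ring) (by field_simp) (by ring) (by ring)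
      rw [ternaryIsotropic_iff' hc' two_ne_zero]
      exact ((H2.add (.refl {2})).trans (by convert R using 1; abel)).cancel' {e * (μ : K)}
        (by abel) (by rw [mul_comm (c : K)]; abel)
    · rw [ternaryIsotropic_iff hc' two_ne_zero] at H
      rw [ternaryIsotropic_iff hμ' (mul_ne_zero he hc')]
      have H2 : Represents ({e} + {(c : K) * μ}) ({e * μ} + {(c : K)}) :=
        (R.trans (by convert H.add (.refl {e * (μ : K)}) using 1; rw [mul_comm (c : K)]; abel)).cancel'
          {2} (by abel) (by abel)
      exact H2.scale_pair e (1 / e) 1 e 1 (by field_simp) (by ring) (by ring) (by ring)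
  · have R : Represents ({e} + {2} + 3 • {(c : K) * μ})
        (3 • {1} + {e * (μ : K)} + {2 * (c : K)}) :=
      ((h3.add (.refl ({e} + {2} + 3 • {(c : K) * μ}))).trans (by convert h2 using 1; abel)).cancel'
        ((4 * j) • {1}) (by abel) (by abel)
    have R' : Represents ({e} + {2} + {1}) ({e * (μ : K)} + {2 * (c : K)} + {(c : K) * μ}) :=
      ((h4.add (.refl ({e} + {2}))).trans
        (by convert R.add (.refl {(c : K) * μ}) using 1; abel)).cancel' (3 • {1}) (by abel) (by abel)
    rw [(Nat.not_even_iff_odd.1 hm).neg_one_pow, neg_one_mul, neg_one_mul]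
    constructor <;> intro H
    · rw [ternaryIsotropic_neg_iff (mul_ne_zero he hc')] at H
      have H2 : Represents ({(c : K) * μ} + {e * μ}) ({e} + {(c : K)}) :=
        H.scale_pair (c : K) 1 (1 / (c : K)) c 1 (by ring) (by field_simp) (by ring) (by ring)
      rw [ternaryIsotropic_neg_iff' hc' two_ne_zero]
      exact (R'.trans (by convert H2.add (.refl {2 * (c : K)}) using 1; abel)).cancel' {e}
        (by abel) (by rw [mul_comm (c : K)]; abel)
    · rw [ternaryIsotropic_neg_iff two_ne_zero] at H
      rw [ternaryIsotropic_neg_iff' hμ' (mul_ne_zero he hc')]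
      have H2 : Represents ({e} + {(c : K)}) ({(c : K) * μ} + {e * μ}) :=
        ((H.add (.refl {e})).trans (by convert R' using 1; abel)).cancel' {2 * (c : K)}
          (by rw [mul_comm (c : K)]; abel) (by abel)
      exact H2.scale_pair (c : K) 1 (1 / (c : K)) c 1 (by ring) (by field_simp) (by ring) (by ring)

end Cases

/-! ### The necessary conditions. -/

theorem padicHilbertSymbol_eq_iff {p : ℕ} [Fact p.Prime] {a b a' b' : ℚ}
    (h : TernaryIsotropic (a : ℚ_[p]) (b : ℚ_[p]) ↔ TernaryIsotropic (a' : ℚ_[p]) (b' : ℚ_[p])) :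
    padicHilbertSymbol p a b = padicHilbertSymbol p a' b' := by
  unfold padicHilbertSymbol
  classical
  exact if_congr h rfl rfl

theorem corollary4p5 {P ι : Type*} [Fintype P] [DecidableEq P] [Fintype ι]
    (n μ : ℕ) (hn : 5 ≤ n) (hμ : 1 ≤ μ)
    (B : ι → Finset P) (hB : IsCoTriangularDesign B n μ) :
    (n % 4 = 1 → IsSquare μ) ∧
    (n % 4 = 2 → IsSquare ((n - 2) * μ)) ∧
    (n % 4 = 3 → IsSquare (n - 2)) ∧
    (n % 4 = 0 → ∀ (p : ℕ) [Fact p.Prime],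
      padicHilbertSymbol p (μ : ℚ) ((-1) ^ (n / 4) * ((n - 1).choose 2 : ℚ)) =
        padicHilbertSymbol p ((n : ℚ) - 2) ((-1) ^ (n / 4) * 2)) ∧
    (n % 4 = 1 → HasNontrivialSolution ((n : ℤ) - 2) ((-1) ^ ((n - 1) / 4) * 2)) ∧
    (n % 4 = 2 → ∃ x y : ℕ, n - 1 = x ^ 2 + y ^ 2) ∧
    (n % 4 = 3 →
      HasNontrivialSolution (μ : ℤ) ((-1) ^ ((n - 3) / 4) * ((n - 1).choose 2 : ℤ))) := by
  obtain ⟨c, rfl⟩ : ∃ c, n = c + 2 := ⟨n - 2, by omega⟩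
  have hc3 : 3 ≤ c := by omega
  have hc0 : c ≠ 0 := by omega
  have hμ0 : μ ≠ 0 := by omega
  have hcQ : (c : ℚ) ≠ 0 := by exact_mod_cast hc0
  have hμQ : (μ : ℚ) ≠ 0 := by exact_mod_cast hμ0
  have hn1 : c + 2 - 1 = c + 1 := rfl
  have hn2 : c + 2 - 2 = c := rfl
  have hv := two_mul_choose_two c
  rw [hn1, hn2]
  obtain ⟨v, hvdef⟩ : ∃ v, v = (c + 1).choose 2 := ⟨_, rfl⟩
  rw [← hvdef] at hv ⊢
  have hR := hB.represents ℚ hc3 hμ hv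
  obtain ⟨t, ht⟩ := hR.exists_sq_of_coTriangular hc0
  have ht0 : t ≠ 0 := by
    rintro rfl
    have : ((c : ℚ) * μ) ^ v * c ^ (c + 1) ≠ 0 := by positivity
    simp [ht] at this
  -- With `e = 2(c+1)` this says `e * c = 4v`, so `e * c` may be replaced by the binomial
  -- coefficient modulo squares.
  have hvK : ∀ (K : Type) [Field K] [CharZero K], 2 * ((c : K) + 1) * c = v * 2 ^ 2 := by
    intro K _ _
    have : (2 : K) * v = (c + 1) * c := by exact_mod_cast hv
    linear_combination -2 * this
  have a1 : (c + 2) % 4 = 1 → IsSquare μ := fun h => by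
    obtain ⟨m, rfl⟩ : ∃ m, c = 4 * m + 3 := ⟨c / 4, by omega⟩
    obtain ⟨w, rfl⟩ : ∃ w, v = 2 * w := ⟨(m + 1) * (4 * m + 3), by nlinarith⟩
    refine isSquare_of_mul_sq_eq ht0 (t := ((4 * m + 3 : ℕ) * (μ : ℚ)) ^ w *
      ((4 * m + 3 : ℕ) : ℚ) ^ (2 * m + 2)) ?_
    rw [mul_comm, ← ht]; ring
  have a2 : (c + 2) % 4 = 2 → IsSquare (c * μ) := fun h => by
    obtain ⟨m, rfl⟩ : ∃ m, c = 4 * m := ⟨c / 4, by omega⟩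
    obtain ⟨w, rfl⟩ : ∃ w, v = 2 * w := ⟨(4 * m + 1) * m, by nlinarith⟩
    refine isSquare_of_mul_sq_eq (t := t * μ) (s := ((4 * m : ℕ) * (μ : ℚ)) ^ w *
      ((4 * m : ℕ) : ℚ) ^ (2 * m)) (by positivity) ?_
    push_cast at ht ⊢
    linear_combination μ * ht
  have a3 : (c + 2) % 4 = 3 → IsSquare c := fun h => by
    obtain ⟨m, rfl⟩ : ∃ m, c = 4 * m + 1 := ⟨c / 4, by omega⟩
    obtain ⟨w, rfl⟩ : ∃ w, v = 2 * w + 1 := ⟨4 * m ^ 2 + 3 * m, by nlinarith⟩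
    refine isSquare_of_mul_sq_eq (t := t) (s := ((4 * m + 1 : ℕ) * (μ : ℚ)) ^ w *
      ((4 * m + 1 : ℕ) : ℚ) ^ (2 * m + 1)) (by positivity) (mul_right_cancel₀ hμQ ?_)
    rw [← ht]; ring
  refine ⟨a1, a2, a3, fun h p _ => ?_, fun h => ?_, fun h => ?_, fun h => ?_⟩
  · have R := hB.represents ℚ_[p] hc3 hμ hv
    obtain ⟨m, hm⟩ : ∃ m, c = 4 * m + 2 := ⟨c / 4, by omega⟩
    have hm4 : (c + 2) / 4 = m + 1 := by omega
    -- Here `v = (4m+3)(2m+1)`, which is 3 modulo 4 for even `m` and 1 for odd `m`; this fixes the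
    -- sign `(-1) ^ (m + 1)`.
    have hv' : ∃ j, v = 4 * j + if Even (m + 1) then 1 else 3 := by
      rcases Nat.even_or_odd' m with ⟨i, rfl | rfl⟩
      · refine ⟨8 * i ^ 2 + 5 * i, ?_⟩
        rw [if_neg (by simp)]
        subst hm; nlinarith
      · refine ⟨8 * i ^ 2 + 13 * i + 5, ?_⟩
        rw [if_pos (by simp [parity_simps])]
        subst hm; nlinarith
    obtain ⟨j, hj⟩ := hv'
    have key := ternaryIsotropic_iff_of_represents hc0 hμ0
      (mul_ne_zero two_ne_zero (Nat.cast_add_one_ne_zero c)) hj (show c + 2 = 4 * (m + 1) by omega) R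
    rw [hvK, ← mul_assoc, TernaryIsotropic.mul_sq_iff two_ne_zero] at key
    refine padicHilbertSymbol_eq_iff ?_
    rw [hm4]
    push_cast
    rw [add_sub_cancel_right]
    exact key
  · obtain ⟨m, hm⟩ : ∃ m, c = 4 * m + 3 := ⟨c / 4, by omega⟩
    obtain ⟨d, hd⟩ := a1 h
    have hd0 : (d : ℚ) ≠ 0 := by rintro h; simp [hd] at hμ0; simp [hμ0] at h
    have hv' : ∃ j, v + c + 2 = 4 * j + if Even (m + 1) then 1 else 3 := by
      rcases Nat.even_or_odd' m with ⟨i, rfl | rfl⟩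
      · refine ⟨8 * i ^ 2 + 9 * i + 2, ?_⟩
        rw [if_neg (by simp)]
        subst hm; nlinarith
      · refine ⟨8 * i ^ 2 + 17 * i + 9, ?_⟩
        rw [if_pos (by simp [parity_simps])]
        subst hm; nlinarith
    obtain ⟨j, hj⟩ := hv'
    have key := ternaryIsotropic_of_represents_one hc0 hd0 (by rw [hd]; push_cast; ring) hj hR
    refine TernaryIsotropic.hasNontrivialSolution ?_
    rw [show (c + 1) / 4 = m + 1 by omega]
    push_cast
    rw [add_sub_cancel_right]
    exact key
  · obtain ⟨m, hm⟩ : ∃ m, c = 4 * m := ⟨c / 4, by omega⟩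
    obtain ⟨d, hd⟩ := a2 h
    have hd0 : (d : ℚ) ≠ 0 := by
      rintro h
      simp only [Nat.cast_eq_zero] at h
      simp [h, hc0, hμ0] at hd
    obtain ⟨x, y, hxy⟩ := exists_eq_two_mul_sq_add_sq hc0 rfl hd0
      (by rw [sq]; exact_mod_cast hd) hm hR
    exact Nat.exists_sq_add_sq_of_rat (x := x) (y := y) (by push_cast; linarith)
  · obtain ⟨m, hm⟩ : ∃ m, c = 4 * m + 1 := ⟨c / 4, by omega⟩
    obtain ⟨d, hd⟩ := a3 h
    have hd0 : (d : ℚ) ≠ 0 := by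
      rintro h
      simp only [Nat.cast_eq_zero] at h
      simp [h, hc0] at hd
    have hv' : ∃ j, v = 4 * j + if Even m then 1 else 3 := by
      rcases Nat.even_or_odd' m with ⟨i, rfl | rfl⟩
      · refine ⟨8 * i ^ 2 + 3 * i, ?_⟩
        rw [if_pos (by simp)]
        subst hm; nlinarith
      · refine ⟨8 * i ^ 2 + 11 * i + 3, ?_⟩
        rw [if_neg (by simp)]
        subst hm; nlinarith
    obtain ⟨j, hj⟩ := hv'
    have key := ternaryIsotropic_of_represents_three hμ0 (by positivity) hd0
      (by rw [sq]; exact_mod_cast hd) hj hR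
    refine TernaryIsotropic.hasNontrivialSolution ?_
    rw [show (c + 2 - 3) / 4 = m by omega]
    push_cast
    -- Since `4v = e * c` and `c = d²`, the coefficients `v` and `e` differ by a square factor.
    rw [← TernaryIsotropic.mul_sq_iff two_ne_zero, mul_assoc, ← hvK,
      show (c : ℚ) = d ^ 2 by rw [sq]; exact_mod_cast hd, ← mul_assoc,
      TernaryIsotropic.mul_sq_iff hd0]
    rw [show (c : ℚ) = d ^ 2 by rw [sq]; exact_mod_cast hd] at key
    exact key
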